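/- Let $\mathcal{B}an$ be the category of complex Banach spaces and continuous linear maps, with the completed projective tensor product $\hat\otimes$, and let $\mathcal{I}nd(\mathcal{B}an)$ be its category of ind-objects (indexed by filtering categories which are small for a universe containing that of the Banach spaces), with the internal tensor product characterized by $$(\text{“}\varinjlim_{i}\text{”}\,E_i)\mathbin{\hat\otimes}(\text{“}\varinjlim_{j}\text{”}\,F_j)=\varinjlim_{i}\varinjlim_{j}\text{“}E_i\mathbin{\hat\otimes}F_j\text{”}.$$ A morphism is a strict epimorphism if it is a cokernel; a complex is strictly exact in degree $k$ if $d^{k-1}$ is strict and $\operatorname{im} d^{k-1}=\ker d^{k}$; the derived category $D(\mathcal{I}nd(\mathcal{B}an))$ is the localization of the homotopy category $K(\mathcal{I}nd(\mathcal{B}an))$ by the complexes which are strictly exact in every degree. An object $P$ is projective if every morphism from $P$ lifts through every strict epimorphism. A projective resolution of $F$ is a complex $P^\bullet$ of projective objects, zero in positive degrees, with a morphism $P^\bullet\to F$ whose mapping cone is strictly exact (up to homotopy equivalence), and $E\mathbin{\hat\otimes}^{\mathrm L}F$ is the image of $E\mathbin{\hat\otimes}P^\bullet$ in $D(\mathcal{I}nd(\mathcal{B}an))$.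 A bounded operator $f:X\to Y$ of Banach spaces is nuclear if $f(x)=\sum_{n}\lambda_n\langle x_n^*,x\rangle y_n$ for all $x\in X$, with $(\lambda_n)$ summable and $(x_n^*)$, $(y_n)$ bounded in $X^*$ and $Y$. An object of $\mathcal{I}nd(\mathcal{B}an)$ is nuclear if it is isomorphic to $\text{“}\varinjlim_{i\in I}\text{”}\,X_i$ for an inductive system of Banach spaces over a filtering ordered set $I$ such that for each $i\in I$ there is $j\ge i$ for which the transition morphism $X_i\to X_j$ is nuclear. Proposition. Let $E$ and $F$ be objects of $\mathcal{I}nd(\mathcal{B}an)$ and assume that $E$ is nuclear. Then $F$ has projective resolutions, and for each of them the canonical morphism $$E\mathbin{\hat\otimes}^{\mathrm L}F\to E\mathbin{\hat\otimes}F$$ is an isomorphism in $D(\mathcal{I}nd(\mathcal{B}an))$. This applies in particular to $E=\mathrm{IB}(D)$ for a DFN space $D$: if $D$ is isomorphic to the strong dual of a nuclear Fréchet space, then $\mathrm{IB}(D)=\text{“}\varinjlim_{B}\text{”}\,\widehat{D}_B$ is nuclear, where $B$ runs through the absolutely convex bounded subsets of $D$ and $\widehat{D}_B$ is the completion of the linear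 hull of $B$ for the gauge of $B$. -/

import Mathlib

open CategoryTheory Limits
open scoped TensorProduct ZeroObject

universe w u

namespace BanInd

noncomputable section

/-- The category of complex Banach spaces and continuous linear maps. -/
structure Ban : Type (u + 1) where
  carrier : Type u
  [normedAddCommGroup : NormedAddCommGroup carrier]
  [normedSpace : NormedSpace ℂ carrier]
  [completeSpace : CompleteSpace carrier]

attribute [instance] Ban.normedAddCommGroup Ban.normedSpace Ban.completeSpace

instance : CoeSort Ban.{u} (Type u) := ⟨Ban.carrier⟩

instance : Category.{u} Ban.{u} where
  Hom X Y := X →L[ℂ] Y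
  id X := ContinuousLinearMap.id ℂ X
  comp f g := ContinuousLinearMap.comp g f

instance : ConcreteCategory Ban.{u} (fun X Y => X →L[ℂ] Y) where
  hom f := f
  ofHom f := f

instance : Preadditive Ban.{u} where
  homGroup X Y := inferInstanceAs (AddCommGroup (X →L[ℂ] Y))
  add_comp _ _ _ f f' g := ContinuousLinearMap.comp_add g f f'
  comp_add _ _ _ f g g' := ContinuousLinearMap.add_comp g g' f

instance : HasZeroObject Ban.{u} :=
  ⟨⟨Ban.mk PUnit, (IsZero.iff_id_eq_zero _).2 (ContinuousLinearMap.ext fun _ => rfl)⟩⟩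

instance : HasBinaryBiproducts Ban.{u} where
  has_binary_biproduct X Y := HasBinaryBiproduct.mk
    { bicone :=
        { pt := Ban.mk (X × Y)
          fst := ContinuousLinearMap.fst ℂ X Y
          snd := ContinuousLinearMap.snd ℂ X Y
          inl := ContinuousLinearMap.inl ℂ X Y
          inr := ContinuousLinearMap.inr ℂ X Y
          inl_fst := ContinuousLinearMap.ext fun _ => rfl
          inl_snd := ContinuousLinearMap.ext fun _ => rfl
          inr_fst := ContinuousLinearMap.ext fun _ => rfl
          inr_snd := ContinuousLinearMap.ext fun _ => rfl }
      isBilimit := isBinaryBilimitOfTotal _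
        (ContinuousLinearMap.ext fun x => Prod.ext (add_zero x.1) (zero_add x.2)) }

/-- `Ban` with its sets of morphisms lifted to the universe `max w u`, an equivalent category. Its
ind-objects are indexed by filtering categories which are small for the universe `max w u`, so that
any universe containing `u` is allowed. -/
abbrev BanLift := ULiftHom.{w} Ban.{u}

instance : Preadditive BanLift.{w, u} :=
  .ofFullyFaithful (F := (ULiftHom.down : BanLift.{w, u} ⥤ Ban.{u})) ULiftHom.equiv.symm.fullyFaithfulFunctor

instance : HasFiniteBiproducts BanLift.{w, u} :=
  haveI : HasFiniteProducts Ban.{u} := hasFiniteProducts_of_has_binary_and_terminal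
  haveI : HasFiniteProducts BanLift.{w, u} :=
    haveI : (ULiftHom.down : BanLift.{w, u} ⥤ Ban.{u}).IsEquivalence :=
      ULiftHom.equiv.isEquivalence_inverse
    ⟨fun _ => Adjunction.hasLimitsOfShape_of_equivalence (ULiftHom.down : BanLift.{w, u} ⥤ Ban.{u})⟩
  .of_hasFiniteProducts

/-- The category `Ind(Ban)` of ind-objects of `Ban`. -/
abbrev IndBan := Ind BanLift.{w, u}

/-! ### The additive structure of `Ind(Ban)` -/

lemma preservesFiniteLimits_of_isIndObject {C : Type*} [Category.{w} C] {A : Cᵒᵖ ⥤ Type w}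
    (hA : IsIndObject A) : PreservesFiniteLimits A := by
  obtain ⟨⟨P⟩⟩ := hA
  have h1 : PreservesFiniteLimits (P.F ⋙ yoneda).flip := by
    apply preservesFiniteLimits_of_evaluation
    intro i
    exact inferInstanceAs (PreservesFiniteLimits (yoneda.obj (P.F.obj i)))
  have h2 : PreservesFiniteLimits ((P.F ⋙ yoneda).flip ⋙ colim) := comp_preservesFiniteLimits _ _
  exact preservesFiniteLimits_of_natIso ((colimitIsoFlipCompColim (P.F ⋙ yoneda)).symm ≪≫
    (colimit.isColimit _).coconePointUniqueUpToIso P.isColimit)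

/-- The embedding of `Ind(Ban)` into left exact presheaves of sets on `Ban`. -/
def indToLeftExact : IndBan.{w, u} ⥤ (BanLift.{w, u}ᵒᵖ ⥤ₗ Type max u w) :=
  ObjectProperty.lift _ (Ind.inclusion BanLift.{w, u})
    fun X => preservesFiniteLimits_of_isIndObject X.isIndObject_inclusion_obj

/-- The embedding `indToLeftExact` is fully faithful. -/
def indToLeftExactFullyFaithful : indToLeftExact.{w, u}.FullyFaithful where
  preimage f := Ind.inclusion.fullyFaithful.preimage f.hom
  map_preimage f := by
    ext : 1
    exact Ind.inclusion.fullyFaithful.map_preimage f.hom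
  preimage_map f := Ind.inclusion.fullyFaithful.preimage_map f

/-- Left exact presheaves of sets on the additive category `Ban` have a unique structure of left
exact presheaves of abelian groups, so that `Ind(Ban)` is additive. -/
instance : Preadditive IndBan.{w, u} :=
  haveI : HasFiniteBiproducts BanLift.{w, u}ᵒᵖ := .of_hasFiniteProducts
  .ofFullyFaithful ((indToLeftExactFullyFaithful.comp
    (AddCommGrpCat.leftExactFunctorForgetEquivalence
      (BanLift.{w, u}ᵒᵖ)).symm.fullyFaithfulFunctor).comp
        (ObjectProperty.fullyFaithfulι _))

instance : HasFiniteBiproducts IndBan.{w, u} :=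
  haveI : HasFiniteCoproducts IndBan.{w, u} :=
    ⟨fun _ => hasColimitsOfShape_of_equivalence (Discrete.equivalence Equiv.ulift)⟩
  HasFiniteBiproducts.of_hasFiniteCoproducts

instance : HasBinaryBiproducts IndBan.{w, u} := hasBinaryBiproducts_of_finite_biproducts _


/-! ### Completions of seminormed spaces -/

section Completion

variable {U V W : Type u} [AddCommGroup U] [Module ℂ U] [AddCommGroup V] [Module ℂ V]
  [AddCommGroup W] [Module ℂ W]

/-- The vector space `V` endowed with the seminorm `p`. -/
def WithSeminorm (_p : Seminorm ℂ V) : Type u := V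

instance (p : Seminorm ℂ V) : AddCommGroup (WithSeminorm p) := inferInstanceAs (AddCommGroup V)

/-- The seminorm `p`, as a group seminorm on `WithSeminorm p`. -/
def WithSeminorm.seminorm (p : Seminorm ℂ V) : AddGroupSeminorm (WithSeminorm p) :=
  p.toAddGroupSeminorm

instance (p : Seminorm ℂ V) : SeminormedAddCommGroup (WithSeminorm p) :=
  (WithSeminorm.seminorm p).toSeminormedAddCommGroup

instance (p : Seminorm ℂ V) : NormedSpace ℂ (WithSeminorm p) where
  toModule := inferInstanceAs (Module ℂ V)
  norm_smul_le a x := (map_smul_eq_mul p a (show V from x)).le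

/-- The (Hausdorff) completion of the seminormed space `(V, p)`. -/
def completion (p : Seminorm ℂ V) : Ban.{u} := Ban.mk (UniformSpace.Completion (WithSeminorm p))

/-- The canonical linear map from `V` to the completion of `(V, p)`. -/
def toCompletion (p : Seminorm ℂ V) : V →ₗ[ℂ] completion p :=
  (UniformSpace.Completion.toComplL (𝕜 := ℂ) (E := WithSeminorm p)).toLinearMap

/-- A linear map which is bounded for the given seminorms, as a continuous linear map. -/
def boundedMap (p : Seminorm ℂ V) (q : Seminorm ℂ W) (f : V →ₗ[ℂ] W)
    (hf : ∃ C : ℝ, ∀ x, q (f x) ≤ C * p x) : WithSeminorm p →L[ℂ] WithSeminorm q :=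
  LinearMap.mkContinuousOfExistsBound
    { toFun := f, map_add' := map_add f, map_smul' := map_smul f } hf

/-- The bounded operator between completions induced by a linear map which is bounded for the
given seminorms. -/
def completionMap (p : Seminorm ℂ V) (q : Seminorm ℂ W) (f : V →ₗ[ℂ] W)
    (hf : ∃ C : ℝ, ∀ x, q (f x) ≤ C * p x) : completion p ⟶ completion q :=
  (boundedMap p q f hf).completion

lemma completionMap_coe (p : Seminorm ℂ V) (q : Seminorm ℂ W) (f : V →ₗ[ℂ] W)
    (hf : ∃ C : ℝ, ∀ x, q (f x) ≤ C * p x) (x : V) :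
    completionMap p q f hf (toCompletion p x) = toCompletion q (f x) :=
  ContinuousLinearMap.completion_apply_coe (α := WithSeminorm p) (β := WithSeminorm q) _ _

lemma completion_hom_ext {p : Seminorm ℂ V} {X : Ban.{u}} {f g : completion p ⟶ X}
    (h : ∀ x : V, f (toCompletion p x) = g (toCompletion p x)) : f = g :=
  ContinuousLinearMap.ext fun x => UniformSpace.Completion.induction_on (α := WithSeminorm p) x
    (isClosed_eq (ContinuousLinearMap.continuous f) (ContinuousLinearMap.continuous g)) h

lemma completionMap_id (p : Seminorm ℂ V) (hf) :
    completionMap p p LinearMap.id hf = 𝟙 _ :=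
  completion_hom_ext fun x => completionMap_coe p p LinearMap.id hf x

lemma completionMap_comp (p : Seminorm ℂ U) (q : Seminorm ℂ V) (r : Seminorm ℂ W)
    (f : U →ₗ[ℂ] V) (g : V →ₗ[ℂ] W) (hf) (hg) (hfg) :
    completionMap p q f hf ≫ completionMap q r g hg = completionMap p r (g ∘ₗ f) hfg := by
  refine completion_hom_ext fun x => ?_
  change completionMap q r g hg (completionMap p q f hf _) = _
  rw [completionMap_coe, completionMap_coe, completionMap_coe]
  rfl

lemma completionMap_zero (p : Seminorm ℂ V) (q : Seminorm ℂ W) (hf) :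
    completionMap p q 0 hf = 0 :=
  completion_hom_ext fun x => (completionMap_coe p q 0 hf x).trans (map_zero _)

end Completion

/-! ### The completed projective tensor product of Banach spaces -/

section Projective

variable (X Y : Ban.{u})

/-- The numbers `∑ᵢ ‖xᵢ‖ ‖yᵢ‖`, for all the finite representations `z = ∑ᵢ xᵢ ⊗ yᵢ`. -/
def projCosts (z : X ⊗[ℂ] Y) : Set ℝ :=
  {r | ∃ l : List (X × Y), (l.map fun a => a.1 ⊗ₜ[ℂ] a.2).sum = z ∧
    (l.map fun a => ‖a.1‖ * ‖a.2‖).sum = r}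

variable {X Y}

lemma projCosts_nonneg {z : X ⊗[ℂ] Y} {r : ℝ} (hr : r ∈ projCosts X Y z) : 0 ≤ r := by
  obtain ⟨l, -, rfl⟩ := hr
  refine List.sum_nonneg fun a ha => ?_
  obtain ⟨b, -, rfl⟩ := List.mem_map.1 ha
  positivity

lemma projCosts_bddBelow (z : X ⊗[ℂ] Y) : BddBelow (projCosts X Y z) :=
  ⟨0, fun _ => projCosts_nonneg⟩

lemma projCosts_add {z z' : X ⊗[ℂ] Y} {r r' : ℝ} (hr : r ∈ projCosts X Y z)
    (hr' : r' ∈ projCosts X Y z') : r + r' ∈ projCosts X Y (z + z') := by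
  obtain ⟨l, rfl, rfl⟩ := hr
  obtain ⟨l', rfl, rfl⟩ := hr'
  exact ⟨l ++ l', by simp, by simp⟩

lemma projCosts_nonempty (z : X ⊗[ℂ] Y) : (projCosts X Y z).Nonempty := by
  induction z with
  | zero => exact ⟨0, [], by simp, by simp⟩
  | tmul x y => exact ⟨‖x‖ * ‖y‖, [(x, y)], by simp, by simp⟩
  | add z z' h h' =>
    obtain ⟨r, hr⟩ := h
    obtain ⟨r', hr'⟩ := h'
    exact ⟨r + r', projCosts_add hr hr'⟩

lemma projCosts_map {X' Y' : Ban.{u}} (f : X →L[ℂ] X') (g : Y →L[ℂ] Y') {z : X ⊗[ℂ] Y} {r : ℝ}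
    (hr : r ∈ projCosts X Y z) :
    ∃ r' ∈ projCosts X' Y' (TensorProduct.map f.toLinearMap g.toLinearMap z),
      r' ≤ ‖f‖ * ‖g‖ * r := by
  obtain ⟨l, rfl, rfl⟩ := hr
  refine ⟨_, ⟨l.map fun a => (f a.1, g a.2), ?_, rfl⟩, ?_⟩
  · rw [map_list_sum, List.map_map, List.map_map]
    rfl
  · rw [List.map_map, ← List.sum_map_mul_left]
    refine List.sum_le_sum fun a _ => ?_
    calc ‖f a.1‖ * ‖g a.2‖ ≤ (‖f‖ * ‖a.1‖) * (‖g‖ * ‖a.2‖) := by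
          gcongr
          · exact f.le_opNorm _
          · exact g.le_opNorm _
      _ = _ := by ring

variable (X Y)

/-- The projective seminorm on the algebraic tensor product of two Banach spaces. -/
def projSeminorm : Seminorm ℂ (X ⊗[ℂ] Y) :=
  Seminorm.ofSMulLE (fun z => sInf (projCosts X Y z))
    (le_antisymm (csInf_le (projCosts_bddBelow 0) ⟨[], by simp, by simp⟩)
      (le_csInf (projCosts_nonempty 0) fun _ => projCosts_nonneg))
    (fun z z' => by
      refine le_of_forall_pos_le_add fun ε hε => ?_
      obtain ⟨r, hr, h⟩ := exists_lt_of_csInf_lt (projCosts_nonempty z)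
        (lt_add_of_pos_right _ (half_pos hε))
      obtain ⟨r', hr', h'⟩ := exists_lt_of_csInf_lt (projCosts_nonempty z')
        (lt_add_of_pos_right _ (half_pos hε))
      have := csInf_le (projCosts_bddBelow (z + z')) (projCosts_add hr hr')
      linarith)
    (fun c z => by
      rw [← smul_eq_mul, ← Real.sInf_smul_of_nonneg (norm_nonneg c)]
      refine le_csInf ((projCosts_nonempty z).smul_set) ?_
      rintro _ ⟨_, ⟨l, rfl, rfl⟩, rfl⟩
      refine csInf_le (projCosts_bddBelow _) ⟨l.map fun a => (c • a.1, a.2), ?_, ?_⟩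
      · rw [List.smul_sum, List.map_map, List.map_map]
        rfl
      · simp only [List.map_map, smul_eq_mul, ← List.sum_map_mul_left]
        congr 1
        refine List.map_congr_left fun a _ => ?_
        simp [norm_smul, mul_assoc])

variable {X Y}

lemma projSeminorm_map_le {X' Y' : Ban.{u}} (f : X →L[ℂ] X') (g : Y →L[ℂ] Y') (z : X ⊗[ℂ] Y) :
    projSeminorm X' Y' (TensorProduct.map f.toLinearMap g.toLinearMap z) ≤
      ‖f‖ * ‖g‖ * projSeminorm X Y z := by
  change sInf _ ≤ _ * sInf _
  rw [← smul_eq_mul, ← Real.sInf_smul_of_nonneg (by positivity)]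
  refine le_csInf ((projCosts_nonempty z).smul_set) ?_
  rintro _ ⟨r, hr, rfl⟩
  obtain ⟨r', hr', h⟩ := projCosts_map f g hr
  exact (csInf_le (projCosts_bddBelow _) hr').trans h

/-- The operator `f ⊗̂ g` between completed projective tensor products. -/
def projMap {X' Y' : Ban.{u}} (f : X ⟶ X') (g : Y ⟶ Y') :
    completion (projSeminorm X Y) ⟶ completion (projSeminorm X' Y') :=
  completionMap _ _ (TensorProduct.map (ContinuousLinearMap.toLinearMap f)
    (ContinuousLinearMap.toLinearMap g)) ⟨_, projSeminorm_map_le f g⟩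

lemma projMap_id : projMap (𝟙 X) (𝟙 Y) = 𝟙 _ :=
  completion_hom_ext fun z => (completionMap_coe _ _ _ _ z).trans
    (congrArg _ (LinearMap.congr_fun TensorProduct.map_id z))

lemma projMap_comp {X' Y' X'' Y'' : Ban.{u}} (f : X ⟶ X') (g : Y ⟶ Y') (f' : X' ⟶ X'')
    (g' : Y' ⟶ Y'') : projMap (f ≫ f') (g ≫ g') = projMap f g ≫ projMap f' g' := by
  refine completion_hom_ext fun z => ?_
  change projMap _ _ _ = projMap f' g' (projMap f g _)
  unfold projMap
  rw [completionMap_coe, completionMap_coe, completionMap_coe]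
  refine congrArg _ ?_
  exact LinearMap.congr_fun (TensorProduct.map_comp (ContinuousLinearMap.toLinearMap f')
    (ContinuousLinearMap.toLinearMap g') (ContinuousLinearMap.toLinearMap f)
    (ContinuousLinearMap.toLinearMap g)) z

lemma projMap_zero {X' Y' : Ban.{u}} (f : X ⟶ X') : projMap f (0 : Y ⟶ Y') = 0 :=
  completion_hom_ext fun z => (completionMap_coe _ _ _ _ z).trans
    ((congrArg _ (LinearMap.congr_fun (TensorProduct.map_zero_right
      (ContinuousLinearMap.toLinearMap f)) z)).trans (map_zero _))

/-- The completed projective tensor product `⊗̂ : Ban × Ban → Ban`. -/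
def tensorBan : Ban.{u} ⥤ Ban.{u} ⥤ Ban.{u} where
  obj X :=
    { obj Y := completion (projSeminorm X Y)
      map g := projMap (𝟙 X) g
      map_id _ := projMap_id
      map_comp g g' := by rw [← projMap_comp, Category.comp_id] }
  map f :=
    { app Y := projMap f (𝟙 Y)
      naturality _ _ g := by
        rw [← projMap_comp, ← projMap_comp]
        simp }
  map_id _ := NatTrans.ext (funext fun _ => projMap_id)
  map_comp f f' := NatTrans.ext (funext fun Y => by
    change projMap (f ≫ f') (𝟙 Y) = projMap f (𝟙 Y) ≫ projMap f' (𝟙 Y)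
    rw [← projMap_comp, Category.comp_id])

instance (X : Ban.{u}) : (tensorBan.obj X).PreservesZeroMorphisms where
  map_zero _ _ := projMap_zero (𝟙 X)

end Projective

/-! ### The internal tensor product of `Ind(Ban)` -/

/-- The functor sending a Banach space `X` to the constant ind-object `"X"`. -/
def constInd : Ban.{u} ⥤ IndBan.{w, u} := ULiftHom.up ⋙ Ind.yoneda

/-- The ind-object `"lim" X_i` associated to a filtering inductive system of Banach spaces. -/
def indLim {I : Type max u w} [SmallCategory I] [IsFiltered I] (X : I ⥤ Ban.{u}) :
    IndBan.{w, u} :=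
  (Ind.lim I).obj (X ⋙ ULiftHom.up)

instance : (constInd.{w, u}).Full :=
  haveI : (ULiftHom.up : Ban.{u} ⥤ BanLift.{w, u}).IsEquivalence :=
    ULiftHom.equiv.isEquivalence_functor
  inferInstanceAs (ULiftHom.up ⋙ Ind.yoneda).Full

instance : (constInd.{w, u}).Faithful :=
  haveI : (ULiftHom.up : Ban.{u} ⥤ BanLift.{w, u}).IsEquivalence :=
    ULiftHom.equiv.isEquivalence_functor
  inferInstanceAs (ULiftHom.up ⋙ Ind.yoneda).Faithful

instance (E : IndBan.{w, u}) : HasColimitsOfShape (CostructuredArrow constInd E) IndBan.{w, u} := by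
  have : (ULiftHom.up : Ban.{u} ⥤ BanLift.{w, u}).IsEquivalence :=
    ULiftHom.equiv.isEquivalence_functor
  let e : CostructuredArrow constInd E ≌
      CostructuredArrow yoneda ((Ind.inclusion BanLift.{w, u}).obj E) :=
    (CostructuredArrow.pre ULiftHom.up Ind.yoneda E).asEquivalence.trans
      ((CostructuredArrow.post Ind.yoneda (Ind.inclusion BanLift.{w, u}) E).asEquivalence.trans
        (CostructuredArrow.mapNatIso Ind.yonedaCompInclusion))
  have := Functor.Final.hasColimitsOfShape_of_final (E := IndBan.{w, u})
    E.presentation.toCostructuredArrow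
  exact hasColimitsOfShape_of_equivalence e.symm

/-- The functor `F ↦ X ⊗̂ F` from `Ind(Ban)` to itself, for a Banach space `X`. It is given by
`X ⊗̂ "lim" F_j = lim "X ⊗̂ F_j"`. -/
def tensorConst : Ban.{u} ⥤ IndBan.{w, u} ⥤ IndBan.{w, u} :=
  tensorBan ⋙ (Functor.whiskeringRight _ _ _).obj constInd ⋙ constInd.lan

/-- The internal tensor product of `Ind(Ban)`. Since Kan extensions along `constInd` are computed
by filtering inductive limits, `"lim" E_i ⊗̂ "lim" F_j = lim lim "E_i ⊗̂ F_j"`. -/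
def tensorInd : IndBan.{w, u} ⥤ IndBan.{w, u} ⥤ IndBan.{w, u} :=
  constInd.lan.obj tensorConst

lemma isZero_lan_obj {C D H : Type*} [Category* C] [Category* D] [Category* H] (L : C ⥤ D)
    [∀ G : C ⥤ H, L.HasPointwiseLeftKanExtension G] (G : C ⥤ H) [HasZeroMorphisms H]
    (hG : ∀ X, IsZero (G.obj X)) (Y : D) : IsZero ((L.lan.obj G).obj Y) := by
  rw [IsZero.iff_id_eq_zero]
  exact (L.isPointwiseLeftKanExtensionLeftKanExtensionUnit G Y).hom_ext
    fun j => (hG _).eq_of_src _ _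

instance (X : Ban.{u}) : ((tensorConst.{w, u}).obj X).PreservesZeroMorphisms := by
  have e : (constInd.{w, u} ⋙ (tensorConst.{w, u}).obj X).obj 0 ≅
      (tensorBan.obj X ⋙ constInd.{w, u}).obj 0 :=
    (asIso ((constInd.lanUnit.app (tensorBan.obj X ⋙ constInd.{w, u})).app 0)).symm
  have h : IsZero ((tensorBan.obj X ⋙ constInd.{w, u}).obj 0) :=
    (tensorBan.obj X ⋙ constInd.{w, u}).map_isZero (isZero_zero _)
  have h' : IsZero (((tensorConst.{w, u}).obj X).obj (constInd.obj 0)) := h.of_iso e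
  have h0 : IsZero (constInd.{w, u}.obj 0) := constInd.map_isZero (isZero_zero _)
  exact Functor.preservesZeroMorphisms_of_map_zero_object
    (((tensorConst.{w, u}).obj X).mapIso (h0.isoZero.symm) ≪≫ h'.isoZero)

instance (E : IndBan.{w, u}) : ((tensorInd.{w, u}).obj E).PreservesZeroMorphisms := by
  have h := isColimitOfPreserves ((evaluation IndBan.{w, u} IndBan.{w, u}).obj 0)
    (constInd.isPointwiseLeftKanExtensionLeftKanExtensionUnit tensorConst.{w, u} E)
  have h' : IsZero (((tensorInd.{w, u}).obj E).obj 0) := by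
    rw [IsZero.iff_id_eq_zero]
    exact h.hom_ext fun j =>
      (((tensorConst.{w, u}).obj j.left).map_isZero (isZero_zero _)).eq_of_src _ _
  exact Functor.preservesZeroMorphisms_of_map_zero_object h'.isoZero

/-! ### Nuclear objects -/

/-- A bounded operator `f` between Banach spaces is nuclear if `f x = ∑ₙ λₙ ⟨ξₙ, x⟩ yₙ` for a
summable sequence `λ`, a bounded sequence `ξ` in the dual of `X` and a bounded sequence `y`
in `Y`. -/
def IsNuclearMap {X Y : Ban.{u}} (f : X ⟶ Y) : Prop :=
  ∃ (c : ℕ → ℂ) (ξ : ℕ → X →L[ℂ] ℂ) (y : ℕ → Y), Summable c ∧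
    Bornology.IsBounded (Set.range ξ) ∧ Bornology.IsBounded (Set.range y) ∧
    ∀ x : X, HasSum (fun n => (c n * ξ n x) • y n) (f x)

/-- An inductive system of Banach spaces indexed by a filtering ordered set is nuclear if each of
its objects has a nuclear transition morphism to a later one. -/
def IsNuclearSystem {I : Type*} [PartialOrder I] (X : I ⥤ Ban.{u}) : Prop :=
  ∀ i : I, ∃ (j : I) (h : i ≤ j), IsNuclearMap (X.map (homOfLE h))

/-- An object of `Ind(Ban)` is nuclear if it is isomorphic to the ind-object of a nuclear
inductive system. -/
def IsNuclear (E : IndBan.{w, u}) : Prop :=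
  ∃ (I : Type max u w) (_ : PartialOrder I) (_ : Nonempty I) (_ : IsDirectedOrder I)
    (X : I ⥤ Ban.{u}), IsNuclearSystem X ∧ Nonempty (E ≅ indLim.{w, u} X)

/-! ### Quasi-abelian homological algebra -/

section QuasiAbelian

variable {A : Type*} [Category* A] [Preadditive A]

/-- A complex `X₁ ⟶ X₂ ⟶ X₃` is strictly exact if `f : X₁ ⟶ X₂` is strict and the image of `f` is
the kernel of `g : X₂ ⟶ X₃`, that is, if `f` is the composition of a strict epimorphism (a
cokernel) followed by a kernel of `g`. -/
def IsStrictlyExact (S : ShortComplex A) : Prop :=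
  ∃ (Z : A) (e : S.X₁ ⟶ Z) (i : Z ⟶ S.X₂) (hi : i ≫ S.g = 0),
    e ≫ i = S.f ∧ Nonempty (NormalEpi e) ∧ Nonempty (IsLimit (KernelFork.ofι i hi))

/-- An object `P` is projective if morphisms from `P` lift through strict epimorphisms (that is,
cokernels). -/
def IsStrictlyProjective (P : A) : Prop :=
  ∀ ⦃X Y : A⦄ (e : X ⟶ Y) (_ : Nonempty (NormalEpi e)) (f : P ⟶ Y), ∃ g : P ⟶ X, g ≫ e = f

/-- The complexes which are strictly exact in every degree. -/
def strictlyAcyclic (A : Type*) [Category* A] [Preadditive A] :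
    ObjectProperty (HomotopyCategory A (ComplexShape.up ℤ)) :=
  fun K => ∀ n : ℤ, IsStrictlyExact (HomologicalComplex.sc K.as n)

variable [HasZeroObject A] [HasBinaryBiproducts A]

/-- The derived category of `A`: the localization of the homotopy category `K(A)` by the null
system of the complexes which are strictly exact in every degree. -/
abbrev QDerived (A : Type*) [Category* A] [Preadditive A] [HasZeroObject A]
    [HasBinaryBiproducts A] :=
  (strictlyAcyclic A).trW.Localization

/-- The canonical functor from complexes to the derived category. -/
def toQDerived (A : Type*) [Category* A] [Preadditive A] [HasZeroObject A]
    [HasBinaryBiproducts A] : CochainComplex A ℤ ⥤ QDerived A :=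
  HomotopyCategory.quotient A (ComplexShape.up ℤ) ⋙ (strictlyAcyclic A).trW.Q

/-- A projective resolution `⋯ ⟶ P⁻¹ ⟶ P⁰ ⟶ F`. The morphism of complexes `ε : P ⟶ F` is required
to have a strictly exact mapping cone. -/
structure ProjRes (F : A) where
  complex : CochainComplex A ℤ
  isZero : ∀ n : ℤ, 0 < n → IsZero (complex.X n)
  projective : ∀ n : ℤ, IsStrictlyProjective (complex.X n)
  ε : complex ⟶ (HomologicalComplex.single A (ComplexShape.up ℤ) 0).obj F
  isStrictQuasiIso : (strictlyAcyclic A).trW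
    ((HomotopyCategory.quotient A (ComplexShape.up ℤ)).map ε)

end QuasiAbelian

/-- The derived tensor product `E ⊗̂ᴸ F` in the derived category of `Ind(Ban)`, computed as
`E ⊗̂ P` for a projective resolution `P` of `F`. -/
def derivedTensor (E : IndBan.{w, u}) {F : IndBan.{w, u}} (P : ProjRes F) :
    QDerived IndBan.{w, u} :=
  (toQDerived IndBan.{w, u}).obj
    (((tensorInd.obj E).mapHomologicalComplex (ComplexShape.up ℤ)).obj P.complex)

/-- The canonical morphism `E ⊗̂ᴸ F ⟶ E ⊗̂ F`. -/
def derivedTensorToTensor (E : IndBan.{w, u}) {F : IndBan.{w, u}} (P : ProjRes F) :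
    derivedTensor E P ⟶ (toQDerived IndBan.{w, u}).obj
      ((HomologicalComplex.single IndBan.{w, u} (ComplexShape.up ℤ) 0).obj
        ((tensorInd.obj E).obj F)) :=
  (toQDerived IndBan.{w, u}).map
    (((tensorInd.obj E).mapHomologicalComplex (ComplexShape.up ℤ)).map P.ε ≫
      (HomologicalComplex.singleMapHomologicalComplex (tensorInd.obj E)
        (ComplexShape.up ℤ) 0).hom.app F)

/-! ### The functor `IB` on objects, and DFN spaces -/

section TopologicalVectorSpaces

variable (D : Type u) [AddCommGroup D] [Module ℂ D] [TopologicalSpace D]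

/-- The (nonempty) absolutely convex bounded subsets of `D`. -/
structure Disk where
  carrier : Set D
  nonempty : carrier.Nonempty
  balanced : Balanced ℂ carrier
  convex : Convex ℝ carrier
  bounded : Bornology.IsVonNBounded ℂ carrier

/-- Absolutely convex bounded sets are ordered by inclusion. -/
instance : PartialOrder (Disk D) :=
  PartialOrder.lift Disk.carrier fun B B' h => by cases B; cases B'; cases h; rfl

variable {D}

/-- The linear hull of an absolutely convex bounded set. -/
abbrev Disk.hull (B : Disk D) : Submodule ℂ D := Submodule.span ℂ B.carrier

lemma Disk.exists_smul (B : Disk D) {x : D} (hx : x ∈ B.hull) :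
    ∃ r : ℝ, 0 < r ∧ ∃ b ∈ B.carrier, x = r • b := by
  induction hx using Submodule.span_induction with
  | mem x hx => exact ⟨1, one_pos, x, hx, (one_smul _ _).symm⟩
  | zero =>
    obtain ⟨b, hb⟩ := B.nonempty
    exact ⟨1, one_pos, 0, B.balanced.zero_mem ⟨b, hb⟩, by simp⟩
  | add x y _ _ hx hy =>
    obtain ⟨r, hr, b, hb, rfl⟩ := hx
    obtain ⟨r', hr', b', hb', rfl⟩ := hy
    refine ⟨r + r', by positivity, (r / (r + r')) • b + (r' / (r + r')) • b',
      B.convex hb hb' (by positivity) (by positivity) (by field_simp), ?_⟩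
    rw [smul_add, smul_smul, smul_smul, mul_div_cancel₀ _ (by positivity),
      mul_div_cancel₀ _ (by positivity)]
  | smul a x _ hx =>
    obtain ⟨r, hr, b, hb, rfl⟩ := hx
    refine ⟨r * (‖a‖ + 1), by positivity, ((‖a‖ + 1 : ℝ) : ℂ)⁻¹ • a • b, ?_, ?_⟩
    · rw [smul_smul]
      refine B.balanced.smul_mem ?_ hb
      rw [norm_mul, norm_inv, Complex.norm_real, Real.norm_of_nonneg (by positivity),
        inv_mul_le_one₀ (by positivity)]
      linarith
    · rw [mul_smul, ← Complex.coe_smul (‖a‖ + 1), smul_inv_smul₀, smul_comm]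
      exact_mod_cast (by positivity : (‖a‖ + 1 : ℝ) ≠ 0)

lemma Disk.absorbent (B : Disk D) : Absorbent ℝ ((↑) ⁻¹' B.carrier : Set B.hull) := by
  rw [absorbent_iff_inv_smul]
  intro x
  obtain ⟨r, hr, b, hb, hx⟩ := B.exists_smul x.2
  filter_upwards [tendsto_norm_cobounded_atTop.eventually_ge_atTop r] with c hc
  have hc0 : 0 < ‖c‖ := hr.trans_le hc
  change c⁻¹ • (x : D) ∈ B.carrier
  rw [hx, smul_smul, ← Complex.coe_smul]
  refine B.balanced.smul_mem ?_ hb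
  rw [Complex.norm_real, norm_mul, norm_inv, Real.norm_of_nonneg hr.le, inv_mul_le_one₀ hc0]
  exact hc

/-- The gauge seminorm of `B` on the linear hull of `B`. -/
def Disk.gauge (B : Disk D) : Seminorm ℂ B.hull :=
  gaugeSeminorm (s := ((↑) ⁻¹' B.carrier : Set B.hull))
    (fun a ha => by
      rintro _ ⟨x, hx, rfl⟩
      exact B.balanced a ha ⟨x, hx, rfl⟩)
    (B.convex.is_linear_preimage (B.hull.subtype.restrictScalars ℝ).isLinear) B.absorbent

lemma Disk.gauge_inclusion_le {B B' : Disk D} (h : B ≤ B') (x : B.hull) :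
    B'.gauge (Submodule.inclusion (Submodule.span_mono h) x) ≤ 1 * B.gauge x := by
  rw [one_mul]
  change _root_.gauge _ _ ≤ _root_.gauge _ _
  refine csInf_le_csInf ⟨0, fun r hr => hr.1.le⟩ B.absorbent.gauge_set_nonempty ?_
  rintro r ⟨hr, y, hy, rfl⟩
  exact ⟨hr, Submodule.inclusion (Submodule.span_mono h) y, h hy, rfl⟩

/-- The inductive system of the completions of the spaces `E_B`. -/
def diskSystem (D : Type u) [AddCommGroup D] [Module ℂ D] [TopologicalSpace D] :
    Disk D ⥤ Ban.{u} where
  obj B := completion B.gauge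
  map {B B'} h := completionMap B.gauge B'.gauge
    (Submodule.inclusion (Submodule.span_mono (leOfHom h)))
    ⟨1, Disk.gauge_inclusion_le (leOfHom h)⟩
  map_id B := completion_hom_ext fun x => completionMap_coe _ _ _ _ x
  map_comp h h' := completion_hom_ext fun x => by
    change _ = completionMap _ _ _ _ (completionMap _ _ _ _ _)
    rw [completionMap_coe, completionMap_coe, completionMap_coe]
    rfl

lemma disk_down_monotone : Monotone (ULift.down : ULift.{w} (Disk D) → Disk D) := fun _ _ h => h

variable [IsTopologicalAddGroup D] [ContinuousSMul ℂ D]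

instance : Nonempty (Disk D) :=
  ⟨⟨{0}, Set.singleton_nonempty 0, balanced_zero, convex_singleton 0,
    Bornology.isVonNBounded_singleton 0⟩⟩

open scoped Pointwise in
instance : IsDirectedOrder (Disk D) where
  directed B B' :=
    ⟨⟨B.carrier + B'.carrier, B.nonempty.add B'.nonempty, B.balanced.add B'.balanced,
      B.convex.add B'.convex, B.bounded.add B'.bounded⟩,
      fun x hx => ⟨x, hx, 0, B'.balanced.zero_mem B'.nonempty, add_zero x⟩,
      fun x hx => ⟨0, B.balanced.zero_mem B.nonempty, x, hx, zero_add x⟩⟩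

instance : IsDirectedOrder (ULift.{w} (Disk D)) where
  directed B B' := by
    obtain ⟨C, h, h'⟩ := exists_ge_ge B.down B'.down
    exact ⟨⟨C⟩, h, h'⟩

/-- The ind-object `IB(D) = "lim" E_B`, where `B` runs through the absolutely convex bounded
subsets of `D` and `E_B` is the completion of the linear hull of `B`, normed by the gauge of
`B`. -/
def IB (D : Type u) [AddCommGroup D] [Module ℂ D] [TopologicalSpace D] [IsTopologicalAddGroup D]
    [ContinuousSMul ℂ D] : IndBan.{w, u} :=
  indLim (I := ULift.{w} (Disk D)) (disk_down_monotone.functor ⋙ diskSystem D)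

/-- A locally convex space is nuclear if for any continuous seminorm `p` there is a continuous
seminorm `q ≥ p` such that the canonical map `X_q ⟶ X_p` between completions is nuclear. -/
def IsNuclearSpace (X : Type u) [AddCommGroup X] [Module ℂ X] [TopologicalSpace X] : Prop :=
  LocallyConvexSpace ℝ X ∧ ∀ p : Seminorm ℂ X, Continuous p → ∃ q : Seminorm ℂ X, Continuous q ∧
    ∃ h : p ≤ q, IsNuclearMap (completionMap q p LinearMap.id
      ⟨1, fun x => (h x).trans_eq (one_mul _).symm⟩)

/-- A locally convex space is of type DFN if it is isomorphic to the strong dual of a nuclear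
Fréchet space. -/
def IsDFN (D : Type u) [AddCommGroup D] [Module ℂ D] [TopologicalSpace D] : Prop :=
  ∃ (X : Type u) (_ : AddCommGroup X) (_ : Module ℂ X) (_ : UniformSpace X)
    (_ : IsUniformAddGroup X) (_ : ContinuousSMul ℂ X),
    T2Space X ∧ CompleteSpace X ∧ (uniformity X).IsCountablyGenerated ∧ IsNuclearSpace X ∧
      Nonempty (D ≃L[ℂ] (X →L[ℂ] ℂ))

end TopologicalVectorSpaces

end

end BanInd

open BanInd

namespace BanInd

noncomputable section

/-! For nuclear `E` the functor `E ⊗̂ -` preserves strictly exact complexes. It therefore keeps the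
cone of `P ⟶ F` acyclic, and `E ⊗̂ P ⟶ E ⊗̂ F` becomes invertible in the derived category. Flatness
of projective objects plays no role.

Everything is tested on generalized elements `"ℓ¹(S)" ⟶ F`. A morphism from a constant ind-object to
a filtered colimit factors through a stage, `ℓ¹(S)` lifts through surjective operators by the open
mapping theorem, and every Banach space is a quotient of some `ℓ¹(S)`. Hence strict exactness is
plain exactness of all `Hom("ℓ¹(S)", -)` (`isStrictlyExact_iff`), and direct sums of the `"ℓ¹(S)"`
give enough projectives, whence resolutions by iterated syzygies.

An element of `E ⊗̂ F` comes from an operator `φ : ℓ¹(S) ⟶ X ⊗̂ B`. If `f = ∑ cₙ ξₙ ⊗ yₙ : X ⟶ Y` is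
nuclear, contracting `φ` with the `ξₙ` gives an operator `ψ : ℓ¹(S × ℕ) ⟶ B`, and `s ↦ ∑ cₙ yₙ ⊗
ψ(s, n)` recovers the image of `φ` in `Y ⊗̂ B` (`IsNuclearMap.exists_factor`). So a cycle of `E ⊗̂
K` yields a cycle of `K`; exactness of `K` lifts it, and resummation carries the lift back
(`IsNuclear.isStrictlyExact_map`).

For a DFN space, a bounded set `B` of functionals on a Fréchet space is dominated by a continuous
seminorm `p`. If `q ≥ p` makes `X_q ⟶ X_p` nuclear, the transition operator from `B` to the polar of
`q` factors through the transpose of this map (`isNuclearMap_diskSystem`). -/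

instance : (ULiftHom.up : Ban.{u} ⥤ BanLift.{w, u}).IsEquivalence :=
  ULiftHom.equiv.isEquivalence_functor

/-! ### Compactness of constant ind-objects -/

/-- Morphisms out of a constant ind-object are sections of the corresponding presheaf. -/
def coyonedaConstIndIso (T : Ban.{u}) :
    coyoneda.obj (Opposite.op (constInd.{w, u}.obj T)) ≅
      Ind.inclusion BanLift.{w, u} ⋙
        (evaluation _ _).obj (Opposite.op ((ULiftHom.up : Ban.{u} ⥤ BanLift.{w, u}).obj T)) :=
  NatIso.ofComponents (fun E => (Ind.inclusion.fullyFaithful.homEquiv.trans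
    ((Ind.yonedaCompInclusion.app _).homFromEquiv.trans yonedaEquiv)).toIso) (by
      intro E G f
      ext x
      exact congrArg (fun η => ConcreteCategory.hom
        ((Ind.yonedaCompInclusion.inv.app _ ≫ η).app _) (𝟙 _))
        ((Ind.inclusion BanLift.{w, u}).map_comp (X := constInd.obj T) x f))

/-- Filtered colimits of ind-objects are computed on presheaves, and evaluation of presheaves
preserves colimits. -/
instance (T : Ban.{u}) : PreservesFilteredColimitsOfSize.{max u w, max u w}
    (coyoneda.obj (Opposite.op (constInd.{w, u}.obj T))) where
  preserves_filtered_colimits _ _ _ :=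
    preservesColimitsOfShape_of_natIso (coyonedaConstIndIso T).symm

/-- Arrows from constant ind-objects to `E` correspond to the elements of `E` as a presheaf. -/
def costructuredArrowConstIndEquiv (E : IndBan.{w, u}) : CostructuredArrow constInd E ≌
    CostructuredArrow yoneda ((Ind.inclusion BanLift.{w, u}).obj E) :=
  (CostructuredArrow.pre ULiftHom.up Ind.yoneda E).asEquivalence.trans
    ((CostructuredArrow.post Ind.yoneda (Ind.inclusion BanLift.{w, u}) E).asEquivalence.trans
      (CostructuredArrow.mapNatIso Ind.yonedaCompInclusion))

instance (E : IndBan.{w, u}) : IsFiltered (CostructuredArrow constInd E) :=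
  have := E.isIndObject_inclusion_obj.isFiltered
  IsFiltered.of_equivalence (costructuredArrowConstIndEquiv E).symm

instance (E : IndBan.{w, u}) : FinallySmall.{max u w} (CostructuredArrow constInd E) :=
  have := E.isIndObject_inclusion_obj.finallySmall
  finallySmall_of_final_of_finallySmall (costructuredArrowConstIndEquiv E).inverse

instance (E : IndBan.{w, u}) : LocallySmall.{max u w} (CostructuredArrow constInd E) where
  hom_small X Y := small_of_injective (β := ULift.{w} (X.left ⟶ Y.left))
    (f := fun f => ULift.up f.left) fun _ _ h => CostructuredArrow.hom_ext _ _
      (ULift.up_injective h)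

/-- The category of constant objects over `E` is not small, but it is filtered with a small final
subcategory. This brings the colimits of density and of the Kan extensions within reach of
compactness. -/
instance (E : IndBan.{w, u}) (T : Ban.{u}) : PreservesColimitsOfShape (CostructuredArrow constInd E)
    (coyoneda.obj (Opposite.op (constInd.{w, u}.obj T))) :=
  FinallySmall.preservesColimitsOfShape_of_isFiltered.{max u w} _ _

section

variable {J : Type*} [Category* J] {K : J ⥤ IndBan.{w, u}} {c : Cocone K} (hc : IsColimit c)
  (T : Ban.{u}) [PreservesColimitsOfShape J (coyoneda.obj (Opposite.op (constInd.{w, u}.obj T)))]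

include hc

lemma exists_factor_of_isColimit (x : constInd.obj T ⟶ c.pt) :
    ∃ (j : J) (y : constInd.obj T ⟶ K.obj j), y ≫ c.ι.app j = x :=
  Types.jointly_surjective_of_isColimit
    (isColimitOfPreserves (coyoneda.obj (Opposite.op (constInd.{w, u}.obj T))) hc) x

lemma exists_eq_of_isColimit [IsFiltered J] {j : J} (x y : constInd.obj T ⟶ K.obj j)
    (h : x ≫ c.ι.app j = y ≫ c.ι.app j) :
    ∃ (k : J) (f : j ⟶ k), x ≫ K.map f = y ≫ K.map f :=
  (Types.FilteredColimit.isColimit_eq_iff'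
    (isColimitOfPreserves (coyoneda.obj (Opposite.op (constInd.{w, u}.obj T))) hc) x y).1 h

end

/-! ### Presentations and density of constant ind-objects -/

/-- A filtering inductive system of Banach spaces presenting an ind-object. -/
def presentationDiagram (E : IndBan.{w, u}) : E.presentation.I ⥤ Ban.{u} :=
  E.presentation.F ⋙ ULiftHom.down

/-- The colimit cocone of the presentation of an ind-object. -/
def presentationCocone (E : IndBan.{w, u}) : Cocone (presentationDiagram E ⋙ constInd.{w, u}) :=
  (colimit.cocone (E.presentation.F ⋙ Ind.yoneda)).extend E.colimitPresentationCompYoneda.hom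

/-- The cocone `presentationCocone` is a colimit. -/
def isColimitPresentationCocone (E : IndBan.{w, u}) : IsColimit (presentationCocone E) :=
  IsColimit.extendIso (s := colimit.cocone (E.presentation.F ⋙ Ind.yoneda))
    E.colimitPresentationCompYoneda.hom (colimit.isColimit _)

/-- A morphism from a constant ind-object to `E`, as an object of the category indexing `E`. -/
abbrev constOver {E : IndBan.{w, u}} {T : Ban.{u}} (x : constInd.obj T ⟶ E) :
    CostructuredArrow constInd.{w, u} E :=
  CostructuredArrow.mk x

/-- A morphism over `E` between constant ind-objects. -/
abbrev constOverMap {E : IndBan.{w, u}} {T T' : Ban.{u}} {x : constInd.obj T ⟶ E}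
    {x' : constInd.obj T' ⟶ E} (f : T ⟶ T') (hf : constInd.map f ≫ x' = x) :
    constOver x ⟶ constOver x' :=
  CostructuredArrow.homMk f hf

/-- The presentation is already a colimit, and each `"T" ⟶ E` factors through one of its stages; a
cocone on all such arrows is thus determined by its restriction to the presentation. -/
instance : (constInd.{w, u}).IsDense where
  isDenseAt E := by
    let P := presentationCocone E
    let hP : IsColimit P := isColimitPresentationCocone E
    let c (s : Cocone (CostructuredArrow.proj constInd.{w, u} E ⋙ constInd)) :
        Cocone (presentationDiagram E ⋙ constInd.{w, u}) :=
      { pt := s.pt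
        ι :=
          { app j := s.ι.app (constOver (P.ι.app j))
            naturality j k f := 
              (s.w (constOverMap ((presentationDiagram E).map f) (P.w f))).trans (Category.comp_id _).symm } }
    exact ⟨{  desc s := hP.desc (c s)
              fac s x := by
                obtain ⟨j, y, hy⟩ := exists_factor_of_isColimit hP x.left x.hom
                obtain ⟨φ, rfl⟩ := constInd.map_surjective y
                have := s.w (constOverMap φ hy)
                refine Eq.trans ?_ this
                change (𝟙 _ ≫ x.hom) ≫ _ = constInd.map φ ≫ (c s).ι.app j
                rw [Category.id_comp]
                rw [← hP.fac (c s) j, ← hy]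
                exact Category.assoc _ _ _
              uniq s m hm := hP.uniq (c s) m fun j =>
                (congrArg (· ≫ m) (Category.id_comp (P.ι.app j))).symm.trans
                  (hm (constOver (P.ι.app j))) }⟩

instance : (constInd.{w, u}).PreservesZeroMorphisms := inferInstance

instance : (constInd.{w, u}).Additive := by
  have : PreservesLimits (constInd.{w, u}) := by
    unfold constInd
    infer_instance
  have := preservesBinaryBiproducts_of_preservesBinaryProducts constInd.{w, u}
  exact Functor.additive_of_preservesBinaryBiproducts _

/-- Filteredness of the constant objects over `F` turns relations between elements of `F` into
relations between operators. -/
lemma exists_common_constInd {F : IndBan.{w, u}} {B B' : Ban.{u}} (t : constInd.obj B ⟶ F)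
    (t' : constInd.obj B' ⟶ F) :
    ∃ (C : Ban.{u}) (q : constInd.obj C ⟶ F) (s : B ⟶ C) (s' : B' ⟶ C),
      constInd.map s ≫ q = t ∧ constInd.map s' ≫ q = t' := by
  obtain ⟨C, f, g, -⟩ := IsFilteredOrEmpty.cocone_objs (constOver t) (constOver t')
  exact ⟨C.left, C.hom, f.left, g.left, CostructuredArrow.w f, CostructuredArrow.w g⟩

/-- Two operators which agree in the ind-object `F` agree at a later stage of `F`. -/
lemma exists_eq_of_constInd {F : IndBan.{w, u}} {B L : Ban.{u}} (t : constInd.obj B ⟶ F)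
    (φ ψ : L ⟶ B) (h : constInd.map φ ≫ t = constInd.map ψ ≫ t) :
    ∃ (C : Ban.{u}) (q : constInd.obj C ⟶ F) (s : B ⟶ C),
      constInd.map s ≫ q = t ∧ φ ≫ s = ψ ≫ s := by
  obtain ⟨C, f, hf⟩ := exists_eq_of_isColimit (constInd.denseAt F) L (j := constOver t)
    (constInd.map φ) (constInd.map ψ) (by
      change _ ≫ 𝟙 _ ≫ t = _ ≫ 𝟙 _ ≫ t
      rwa [Category.id_comp])
  refine ⟨C.left, C.hom, f.left, CostructuredArrow.w f, constInd.map_injective ?_⟩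
  rw [Functor.map_comp, Functor.map_comp]
  exact hf

lemma hom_ext_of_constInd {F G : IndBan.{w, u}} {f g : F ⟶ G}
    (h : ∀ (B : Ban.{u}) (t : constInd.obj B ⟶ F), t ≫ f = t ≫ g) : f = g := by
  refine (constInd.denseAt F).hom_ext fun j => ?_
  change (𝟙 _ ≫ j.hom) ≫ f = (𝟙 _ ≫ j.hom) ≫ g
  rw [Category.id_comp]
  exact h _ _

/-! ### Generalized elements of the internal tensor product -/

/-- The operator `f ⊗̂ s`. -/
def tensorMap {X X' B B' : Ban.{u}} (f : X ⟶ X') (s : B ⟶ B') :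
    (tensorBan.obj X).obj B ⟶ (tensorBan.obj X').obj B' :=
  (tensorBan.map f).app B ≫ (tensorBan.obj X').map s

lemma tensorMap_eq {X X' B B' : Ban.{u}} (f : X ⟶ X') (s : B ⟶ B') :
    tensorMap f s = projMap f s :=
  (projMap_comp _ _ _ _).symm.trans (by rw [Category.comp_id, Category.id_comp])

/-- The canonical morphism `"X ⊗̂ B" ⟶ X ⊗̂ "B"`. -/
def tensorConstUnit (X B : Ban.{u}) : constInd.{w, u}.obj ((tensorBan.obj X).obj B) ⟶
    (tensorConst.obj X).obj (constInd.obj B) :=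
  (constInd.lanUnit.app (tensorBan.obj X ⋙ constInd)).app B

/-- The canonical morphism `X ⊗̂ F ⟶ "X" ⊗̂ F`. -/
def tensorIndUnit (X : Ban.{u}) (F : IndBan.{w, u}) : (tensorConst.obj X).obj F ⟶
    (tensorInd.obj (constInd.obj X)).obj F :=
  ((constInd.lanUnit.app tensorConst).app X).app F

lemma tensorConstUnit_naturality_left {X X' : Ban.{u}} (f : X ⟶ X') (B : Ban.{u}) :
    tensorConstUnit.{w, u} X B ≫ (tensorConst.map f).app (constInd.obj B) =
      constInd.map ((tensorBan.map f).app B) ≫ tensorConstUnit X' B :=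
  (NatTrans.congr_app (constInd.lanUnit.naturality
    (((Functor.whiskeringRight _ _ _).obj constInd.{w, u}).map (tensorBan.map f))) B).symm

lemma tensorConstUnit_naturality_right (X : Ban.{u}) {B B' : Ban.{u}} (s : B ⟶ B') :
    tensorConstUnit.{w, u} X B ≫ (tensorConst.obj X).map (constInd.map s) =
      constInd.map ((tensorBan.obj X).map s) ≫ tensorConstUnit X B' :=
  ((constInd.lanUnit.app (tensorBan.obj X ⋙ constInd.{w, u})).naturality s).symm

lemma tensorIndUnit_naturality_left {X X' : Ban.{u}} (f : X ⟶ X') (F : IndBan.{w, u}) :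
    tensorIndUnit X F ≫ (tensorInd.map (constInd.map f)).app F =
      (tensorConst.map f).app F ≫ tensorIndUnit X' F :=
  (NatTrans.congr_app ((constInd.lanUnit.app tensorConst.{w, u}).naturality f) F).symm

lemma tensorIndUnit_naturality_right (X : Ban.{u}) {F G : IndBan.{w, u}} (g : F ⟶ G) :
    tensorIndUnit X F ≫ (tensorInd.obj (constInd.obj X)).map g =
      (tensorConst.obj X).map g ≫ tensorIndUnit X G :=
  (((constInd.lanUnit.app tensorConst.{w, u}).app X).naturality g).symm

/-- The canonical morphism `"X ⊗̂ B" ⟶ X ⊗̂ F` for `t : "B" ⟶ F`. -/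
def toTensorConst (X : Ban.{u}) {F : IndBan.{w, u}} {B : Ban.{u}} (t : constInd.obj B ⟶ F) :
    constInd.obj ((tensorBan.obj X).obj B) ⟶ (tensorConst.obj X).obj F :=
  tensorConstUnit X B ≫ (tensorConst.obj X).map t

/-- The canonical morphism `X ⊗̂ F ⟶ E ⊗̂ F` for `x : "X" ⟶ E`. -/
def tensorConstToTensor {E : IndBan.{w, u}} {X : Ban.{u}} (x : constInd.obj X ⟶ E)
    (F : IndBan.{w, u}) : (tensorConst.obj X).obj F ⟶ (tensorInd.obj E).obj F :=
  tensorIndUnit X F ≫ (tensorInd.map x).app F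

/-- Pointwise Kan extension exhibits `X ⊗̂ F` as the colimit of the `"X ⊗̂ B"` over all `"B" ⟶ F`.
-/
def isColimitTensorConst (X : Ban.{u}) (F : IndBan.{w, u}) :=
  constInd.isPointwiseLeftKanExtensionLeftKanExtensionUnit (tensorBan.obj X ⋙ constInd.{w, u}) F

/-- Colimits of functors are computed pointwise, so `E ⊗̂ F` is the colimit of the `X ⊗̂ F` over all
`"X" ⟶ E`. -/
def isColimitTensorInd (E F : IndBan.{w, u}) :=
  isColimitOfPreserves ((evaluation IndBan.{w, u} IndBan.{w, u}).obj F)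
    (constInd.isPointwiseLeftKanExtensionLeftKanExtensionUnit tensorConst.{w, u} E)

lemma toTensorConst_naturality_right (X : Ban.{u}) {F G : IndBan.{w, u}} {B : Ban.{u}}
    (t : constInd.obj B ⟶ F) (g : F ⟶ G) :
    toTensorConst X t ≫ (tensorConst.obj X).map g = toTensorConst X (t ≫ g) := by
  rw [toTensorConst, toTensorConst, Functor.map_comp, Category.assoc]

lemma toTensorConst_naturality_left {X X' : Ban.{u}} (f : X ⟶ X') {F : IndBan.{w, u}} {B : Ban.{u}}
    (t : constInd.obj B ⟶ F) :
    toTensorConst X t ≫ (tensorConst.map f).app F =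
      constInd.map ((tensorBan.map f).app B) ≫ toTensorConst X' t := by
  rw [toTensorConst, toTensorConst, Category.assoc, (tensorConst.map f).naturality,
    ← Category.assoc, ← Category.assoc, tensorConstUnit_naturality_left]

lemma toTensorConst_comp (X : Ban.{u}) {F : IndBan.{w, u}} {B B' : Ban.{u}}
    (s : B ⟶ B') (t : constInd.obj B' ⟶ F) :
    toTensorConst X (constInd.map s ≫ t) =
      constInd.map ((tensorBan.obj X).map s) ≫ toTensorConst X t := by
  rw [toTensorConst, toTensorConst, Functor.map_comp, ← Category.assoc, ← Category.assoc,
    tensorConstUnit_naturality_right]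

lemma tensorConstToTensor_naturality {E : IndBan.{w, u}} {X : Ban.{u}} (x : constInd.obj X ⟶ E)
    {F G : IndBan.{w, u}} (g : F ⟶ G) :
    tensorConstToTensor x F ≫ (tensorInd.obj E).map g =
      (tensorConst.obj X).map g ≫ tensorConstToTensor x G := by
  rw [tensorConstToTensor, tensorConstToTensor, Category.assoc, ← (tensorInd.map x).naturality,
    ← Category.assoc, ← Category.assoc, tensorIndUnit_naturality_right]

lemma tensorConstToTensor_comp {E : IndBan.{w, u}} {X X' : Ban.{u}} (f : X ⟶ X')
    (x : constInd.obj X' ⟶ E) (F : IndBan.{w, u}) :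
    tensorConstToTensor (constInd.map f ≫ x) F =
      (tensorConst.map f).app F ≫ tensorConstToTensor x F := by
  rw [tensorConstToTensor, tensorConstToTensor, Functor.map_comp, NatTrans.comp_app,
    ← Category.assoc, ← Category.assoc, tensorIndUnit_naturality_left]

/-- The canonical morphism `"X ⊗̂ B" ⟶ E ⊗̂ F` for `x : "X" ⟶ E` and `t : "B" ⟶ F`. -/
def toTensor {E F : IndBan.{w, u}} {X B : Ban.{u}} (x : constInd.obj X ⟶ E)
    (t : constInd.obj B ⟶ F) :
    constInd.obj ((tensorBan.obj X).obj B) ⟶ (tensorInd.obj E).obj F :=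
  toTensorConst X t ≫ tensorConstToTensor x F

section

variable {E F G : IndBan.{w, u}} {X X' B B' L : Ban.{u}}

lemma toTensor_naturality (x : constInd.obj X ⟶ E) (t : constInd.obj B ⟶ F) (g : F ⟶ G) :
    toTensor x t ≫ (tensorInd.obj E).map g = toTensor x (t ≫ g) := by
  rw [toTensor, Category.assoc, tensorConstToTensor_naturality, ← Category.assoc,
    toTensorConst_naturality_right, toTensor]

lemma toTensor_comp (f : X ⟶ X') (x : constInd.obj X' ⟶ E) (s : B ⟶ B')
    (t : constInd.obj B' ⟶ F) :
    toTensor (constInd.map f ≫ x) (constInd.map s ≫ t) =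
      constInd.map (tensorMap f s) ≫ toTensor x t := by
  rw [toTensor, tensorConstToTensor_comp, ← Category.assoc, toTensorConst_naturality_left,
    toTensorConst_comp, toTensor, ← Category.assoc, ← Category.assoc, ← Functor.map_comp]
  rfl

lemma tensorInd_hom_ext {f g : (tensorInd.obj E).obj F ⟶ G}
    (h : ∀ (X B : Ban.{u}) (x : constInd.obj X ⟶ E) (t : constInd.obj B ⟶ F),
      toTensor x t ≫ f = toTensor x t ≫ g) : f = g := by
  refine (isColimitTensorInd E F).hom_ext fun j => ?_
  refine (isColimitTensorConst j.left F).hom_ext fun k => ?_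
  have := h j.left k.left j.hom k.hom
  rwa [toTensor, Category.assoc, Category.assoc] at this

/-- Compactness of `"L"` is applied to the outer colimit, then to the inner one. -/
lemma exists_eq_map_toTensor (u : constInd.obj L ⟶ (tensorInd.obj E).obj F) :
    ∃ (X B : Ban.{u}) (x : constInd.obj X ⟶ E) (t : constInd.obj B ⟶ F)
      (φ : L ⟶ (tensorBan.obj X).obj B), u = constInd.map φ ≫ toTensor x t := by
  obtain ⟨j, u', rfl⟩ := exists_factor_of_isColimit (isColimitTensorInd E F) L u
  obtain ⟨k, u'', rfl⟩ := exists_factor_of_isColimit (isColimitTensorConst j.left F) L u'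
  obtain ⟨φ, rfl⟩ := constInd.map_surjective u''
  exact ⟨j.left, k.left, j.hom, k.hom, φ, Category.assoc _ _ _⟩

/-- The two colimits are undone in turn: the element first dies in `X' ⊗̂ F` for a later `X'`, and
then in `X' ⊗̂ B'`. -/
lemma exists_of_map_toTensor_eq_zero (x : constInd.obj X ⟶ E) (t : constInd.obj B ⟶ F)
    (φ : L ⟶ (tensorBan.obj X).obj B) (h : constInd.map φ ≫ toTensor x t = 0) :
    ∃ (X' B' : Ban.{u}) (x' : constInd.obj X' ⟶ E) (t' : constInd.obj B' ⟶ F)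
      (f : X ⟶ X') (s : B ⟶ B'), constInd.map f ≫ x' = x ∧ constInd.map s ≫ t' = t ∧
        φ ≫ tensorMap f s = 0 := by
  obtain ⟨j, f, hf⟩ := exists_eq_of_isColimit (isColimitTensorInd E F) L (j := constOver x)
    (constInd.map φ ≫ toTensorConst X t) 0
    ((Category.assoc _ _ _).trans (h.trans zero_comp.symm))
  have hf' : constInd.map (φ ≫ (tensorBan.map f.left).app B) ≫ toTensorConst j.left t = 0 := by
    rw [Functor.map_comp, Category.assoc, ← toTensorConst_naturality_left, ← Category.assoc]
    exact hf.trans zero_comp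
  obtain ⟨k, s, hs⟩ := exists_eq_of_isColimit (isColimitTensorConst j.left F) L (j := constOver t)
    (constInd.map (φ ≫ (tensorBan.map f.left).app B)) 0 (hf'.trans zero_comp.symm)
  refine ⟨j.left, k.left, j.hom, k.hom, f.left, s.left, CostructuredArrow.w f,
    CostructuredArrow.w s, constInd.map_injective ?_⟩
  rw [tensorMap, ← Category.assoc, Functor.map_comp, Functor.map_zero]
  exact hs.trans zero_comp

end

/-- A morphism of `Ban`, as a bounded operator. -/
def toCLM {X Y : Ban.{u}} (f : X ⟶ Y) : X →L[ℂ] Y := f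

/-! ### Bounded operators out of completions -/

section

variable {V : Type u} [AddCommGroup V] [Module ℂ V]

lemma norm_toCompletion (p : Seminorm ℂ V) (x : V) : ‖toCompletion p x‖ = p x :=
  UniformSpace.Completion.norm_coe (E := WithSeminorm p) x

lemma denseRange_toCompletion (p : Seminorm ℂ V) : DenseRange (toCompletion p) :=
  UniformSpace.Completion.denseRange_coe (α := WithSeminorm p)

variable {Y : Type*} [NormedAddCommGroup Y] [NormedSpace ℂ Y] [CompleteSpace Y]

/-- The extension to the completion of `(V, p)` of a bounded linear map on `(V, p)`. -/
def completionLift (p : Seminorm ℂ V) (f : V →ₗ[ℂ] Y) : completion p →L[ℂ] Y :=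
  f.extendOfNorm (toCompletion p)

/-- `completionLift` is defined without any bound; the bound is what makes it an extension of `f`.
-/
lemma completionLift_coe (p : Seminorm ℂ V) (f : V →ₗ[ℂ] Y) {C : ℝ}
    (h : ∀ x, ‖f x‖ ≤ C * p x) (x : V) : completionLift p f (toCompletion p x) = f x :=
  LinearMap.extendOfNorm_eq (denseRange_toCompletion p)
    ⟨C, fun x => by rw [norm_toCompletion]; exact h x⟩ x

lemma norm_completionLift_le (p : Seminorm ℂ V) (f : V →ₗ[ℂ] Y) {C : ℝ} (hC : 0 ≤ C)
    (h : ∀ x, ‖f x‖ ≤ C * p x) : ‖completionLift p f‖ ≤ C :=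
  LinearMap.opNorm_extendOfNorm_le (denseRange_toCompletion p) hC
    fun x => by rw [norm_toCompletion]; exact h x

lemma completion_clm_ext {p : Seminorm ℂ V} {X : Ban.{u}} {f g : completion p →L[ℂ] X}
    (h : ∀ x : V, f (toCompletion p x) = g (toCompletion p x)) : f = g :=
  completion_hom_ext (X := X) h

end

/-! ### Operators on the projective tensor product -/

section

variable {X Y X' Y' Z : Ban.{u}}

/-- The canonical bilinear map to the completed projective tensor product. -/
def tprod (x : X) (y : Y) : completion (projSeminorm X Y) :=
  toCompletion (projSeminorm X Y) (x ⊗ₜ y)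

lemma projSeminorm_tmul_le (x : X) (y : Y) : projSeminorm X Y (x ⊗ₜ y) ≤ ‖x‖ * ‖y‖ :=
  csInf_le (projCosts_bddBelow _) ⟨[(x, y)], by simp, by simp⟩

lemma norm_tprod_le (x : X) (y : Y) : ‖tprod x y‖ ≤ ‖x‖ * ‖y‖ :=
  (norm_toCompletion _ _).trans_le (projSeminorm_tmul_le x y)

lemma tensor_clm_ext {f g : completion (projSeminorm X Y) →L[ℂ] Z}
    (h : ∀ x y, f (tprod x y) = g (tprod x y)) : f = g :=
  completion_clm_ext fun z => by
    induction z with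
    | zero => simp
    | tmul x y => exact h x y
    | add z z' h h' => rw [map_add, map_add, map_add, h, h']

lemma projMap_tprod (f : X ⟶ X') (g : Y ⟶ Y') (x : X) (y : Y) :
    projMap f g (tprod x y) = tprod (f x) (g y) :=
  completionMap_coe _ _ _ _ _

/-- The functional-valued contraction `ξ ⊗̂ id : X ⊗̂ Y ⟶ Y`. -/
def contractLeft (ξ : X →L[ℂ] ℂ) (Y : Ban.{u}) : completion (projSeminorm X Y) →L[ℂ] Y :=
  completionLift _ (TensorProduct.lift ((LinearMap.lsmul ℂ Y).comp ξ.toLinearMap))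

lemma norm_list_sum_map_le {α V : Type*} [SeminormedAddCommGroup V] (l : List α) (f : α → V) :
    ‖(l.map f).sum‖ ≤ (l.map fun a => ‖f a‖).sum := by
  induction l with
  | nil => simp
  | cons a l h =>
    rw [List.map_cons, List.sum_cons, List.map_cons, List.sum_cons]
    exact (norm_add_le _ _).trans (by gcongr)

/-- Each finite representation of `z` bounds the left side by `‖ξ‖` times its cost, and the
projective seminorm is the infimum of the costs. -/
lemma norm_lift_le (ξ : X →L[ℂ] ℂ) (z : X ⊗[ℂ] Y) :
    ‖TensorProduct.lift ((LinearMap.lsmul ℂ Y).comp ξ.toLinearMap) z‖ ≤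
      ‖ξ‖ * projSeminorm X Y z := by
  change _ ≤ _ * sInf _
  rw [← smul_eq_mul, ← Real.sInf_smul_of_nonneg (norm_nonneg _)]
  refine le_csInf ((projCosts_nonempty z).smul_set) ?_
  rintro _ ⟨_, ⟨l, rfl, rfl⟩, rfl⟩
  rw [map_list_sum, List.map_map]
  refine (norm_list_sum_map_le _ _).trans ?_
  simp only [smul_eq_mul]
  rw [← List.sum_map_mul_left]
  refine List.sum_le_sum fun a _ => ?_
  calc ‖ξ a.1 • a.2‖ ≤ (‖ξ‖ * ‖a.1‖) * ‖a.2‖ := by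
        rw [norm_smul]
        gcongr
        exact ξ.le_opNorm _
    _ = _ := mul_assoc _ _ _

lemma contractLeft_tprod (ξ : X →L[ℂ] ℂ) (x : X) (y : Y) :
    contractLeft ξ Y (tprod x y) = ξ x • y :=
  completionLift_coe _ _ (norm_lift_le ξ) _

lemma norm_contractLeft_le (ξ : X →L[ℂ] ℂ) (Y : Ban.{u}) : ‖contractLeft ξ Y‖ ≤ ‖ξ‖ :=
  norm_completionLift_le _ _ (norm_nonneg _) (norm_lift_le ξ)

/-- The operator `x ⊗ id : Y ⟶ X ⊗̂ Y`. -/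
def tprodLeft (x : X) (Y : Ban.{u}) : Y →L[ℂ] completion (projSeminorm X Y) :=
  LinearMap.mkContinuous ((toCompletion (projSeminorm X Y)).comp (TensorProduct.mk ℂ X Y x)) ‖x‖
    fun y => norm_tprod_le x y

lemma tprodLeft_apply (x : X) (y : Y) : tprodLeft x Y y = tprod x y := rfl

lemma norm_tprodLeft_le (x : X) (Y : Ban.{u}) : ‖tprodLeft x Y‖ ≤ ‖x‖ :=
  LinearMap.mkContinuous_norm_le _ (norm_nonneg _) _

/-- Tensoring a nuclear operator with a Banach space gives a norm convergent series. -/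
lemma hasSum_projMap {f : X ⟶ X'} {c : ℕ → ℂ} {ξ : ℕ → X →L[ℂ] ℂ} {y : ℕ → X'}
    (hc : Summable c) {A B : ℝ} (hA : ∀ n, ‖ξ n‖ ≤ A) (hB : ∀ n, ‖y n‖ ≤ B)
    (hf : ∀ x : X, HasSum (fun n => (c n * ξ n x) • y n) (f x)) (Y : Ban.{u})
    (z : completion (projSeminorm X Y)) :
    HasSum (fun n => c n • tprodLeft (y n) Y (contractLeft (ξ n) Y z)) (projMap f (𝟙 Y) z) := by
  let T (n : ℕ) : completion (projSeminorm X Y) →L[ℂ] completion (projSeminorm X' Y) :=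
    c n • (tprodLeft (y n) Y).comp (contractLeft (ξ n) Y)
  have hA0 : 0 ≤ A := (norm_nonneg _).trans (hA 0)
  -- The rank-one contributions converge absolutely in operator norm, since `‖T n‖ ≤ ‖c n‖ * (B *
  -- A)`.
  have hT : Summable T := by
    refine Summable.of_norm_bounded (g := fun n => ‖c n‖ * (B * A)) (hc.norm.mul_right _) fun n => ?_
    rw [norm_smul]
    gcongr
    refine (ContinuousLinearMap.opNorm_comp_le _ _).trans ?_
    exact mul_le_mul ((norm_tprodLeft_le _ _).trans (hB n)) ((norm_contractLeft_le _ _).trans (hA n))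
      (norm_nonneg _) ((norm_nonneg _).trans (hB n))
  -- It suffices to compare on elementary tensors, where the identity is the nuclear expansion of `f
  -- x` tensored with `b`.
  have h : ∑' n, T n = projMap f (𝟙 Y) := tensor_clm_ext (Z := completion _) fun x b => by
    refine (hT.hasSum.mapL (ContinuousLinearMap.apply ℂ _ (tprod x b))).unique ?_
    change HasSum (fun n => c n • tprodLeft (y n) Y (contractLeft (ξ n) Y (tprod x b)))
      (projMap f (𝟙 Y) (tprod x b))
    rw [projMap_tprod]
    have := (hf x).mapL (LinearMap.mkContinuous ((toCompletion (projSeminorm X' Y)).comp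
      ((TensorProduct.mk ℂ X' Y).flip b)) ‖b‖ fun y => by
        rw [mul_comm]; exact norm_tprod_le y b)
    have hn (n : ℕ) : c n • tprodLeft (y n) Y (contractLeft (ξ n) Y (tprod x b)) =
        toCompletion (projSeminorm X' Y) (((c n * ξ n x) • y n) ⊗ₜ b) := by
      rw [contractLeft_tprod, map_smul, tprodLeft_apply, ← TensorProduct.smul_tmul', map_smul,
        mul_smul]
      rfl
    simp only [hn]
    exact this
  have := hT.hasSum.mapL (ContinuousLinearMap.apply ℂ _ z)
  rw [h] at this
  exact this

end

/-! ### The spaces `ℓ¹(S)` -/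

section

/-- The Banach space of summable families indexed by `S`. -/
def l1 (S : Type u) : Ban.{u} := Ban.mk (lp (fun _ : S => ℂ) 1)

/-- The unit vectors of `ℓ¹(S)`. -/
def l1Unit {S : Type u} (s : S) : l1 S :=
  haveI := Classical.decEq S
  lp.single (E := fun _ : S => ℂ) 1 s (1 : ℂ)

lemma norm_l1Unit {S : Type u} (s : S) : ‖l1Unit s‖ = 1 :=
  letI := Classical.decEq S
  (lp.norm_single (p := 1) (E := fun _ : S => ℂ) one_pos s (1 : ℂ)).trans norm_one

variable {S : Type u} {X : Ban.{u}}

lemma hasSum_l1Unit (x : lp (fun _ : S => ℂ) 1) : HasSum (fun s => x s • l1Unit s) (x : l1 S) := by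
  classical
  have := lp.hasSum_single (E := fun _ : S => ℂ) ENNReal.one_ne_top x
  have h (s : S) : x s • l1Unit s = lp.single (E := fun _ : S => ℂ) 1 s (x s) := by
    refine (lp.single_smul (E := fun _ : S => ℂ) 1 s (x s) (1 : ℂ)).symm.trans ?_
    rw [smul_eq_mul, mul_one]
  simp only [h]
  exact this

lemma l1_hom_ext {f g : l1 S ⟶ X} (h : ∀ s, f (l1Unit s) = g (l1Unit s)) : f = g :=
  ContinuousLinearMap.ext fun x => by
    have h1 := (hasSum_l1Unit x).mapL (toCLM f)
    have h2 := (hasSum_l1Unit x).mapL (toCLM g)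
    refine h1.unique ?_
    have hs (s : S) : toCLM f (x.1 s • l1Unit s) = toCLM g (x.1 s • l1Unit s) := by
      rw [map_smul, map_smul]
      exact congrArg _ (h s)
    rw [← funext hs] at h2
    exact h2

/-- Universal property of `ℓ¹(S)`: since `∑ ‖x s‖` converges, a bounded family may be prescribed on
the unit vectors. -/
lemma exists_l1_lift (b : S → X) {C : ℝ} (hb : ∀ s, ‖b s‖ ≤ C) :
    ∃ f : l1 S ⟶ X, ∀ s, f (l1Unit s) = b s := by
  classical
  have hs (x : lp (fun _ : S => ℂ) 1) : Summable fun s => ‖x s‖ := by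
    simpa using (lp.memℓp x).summable (by norm_num)
  have hsum (x : lp (fun _ : S => ℂ) 1) : Summable fun s => x s • b s := by
    refine Summable.of_norm_bounded (g := fun s => ‖x s‖ * C) ((hs x).mul_right _) fun s => ?_
    rw [norm_smul]
    gcongr
    exact hb s
  let F : lp (fun _ : S => ℂ) 1 →ₗ[ℂ] X :=
    { toFun x := ∑' s, x s • b s
      map_add' x y := by
        rw [← (hsum x).tsum_add (hsum y)]
        simp [add_smul]
      map_smul' c x := by
        rw [RingHom.id_apply, ← (hsum x).tsum_const_smul]
        simp [mul_smul] }
  refine ⟨F.mkContinuous C fun x => ?_, fun s => ?_⟩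
  · have : ‖x‖ = ∑' s, ‖x s‖ := by
      simpa using lp.norm_eq_tsum_rpow (by norm_num) x
    rw [this, mul_comm, ← tsum_mul_right]
    refine tsum_of_norm_bounded ((hs x).mul_right C).hasSum fun s => ?_
    rw [norm_smul]
    gcongr
    exact hb s
  · refine (tsum_eq_single s fun t ht => ?_).trans ?_
    · change (Pi.single s (1 : ℂ) : S → ℂ) t • b t = 0
      rw [Pi.single_eq_of_ne ht, zero_smul]
    · change (Pi.single s (1 : ℂ) : S → ℂ) s • b s = b s
      rw [Pi.single_eq_same, one_smul]

/-- The spaces `ℓ¹(S)` are projective for surjective operators. -/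
lemma exists_l1_lift_of_surjective {Y Z : Ban.{u}} (e : Y ⟶ Z) (he : Function.Surjective e)
    (f : l1 S ⟶ Z) : ∃ g : l1 S ⟶ Y, g ≫ e = f := by
  -- The open mapping theorem gives preimages with a uniform bound, so the lifted images of the unit
  -- vectors form a bounded family.
  obtain ⟨C, hC, h⟩ := ContinuousLinearMap.exists_preimage_norm_le (toCLM e) he
  choose r hr hr' using h
  obtain ⟨g, hg⟩ := exists_l1_lift (S := S) (fun s => r (f (l1Unit s))) (C := C * ‖toCLM f‖)
    fun s => (hr' _).trans (mul_le_mul_of_nonneg_left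
      (((toCLM f).le_opNorm _).trans_eq (by rw [norm_l1Unit, mul_one])) hC.le)
  refine ⟨g, l1_hom_ext fun s => ?_⟩
  change e (g _) = _
  rw [hg]
  exact hr _

/-- Every Banach space is a quotient of some `ℓ¹(S)`. -/
lemma exists_l1_surjective (X : Ban.{u}) : ∃ f : l1 (ULift.{u} {x : X // ‖x‖ ≤ 1}) ⟶ X, Function.Surjective f := by
  obtain ⟨f, hf⟩ := exists_l1_lift (fun s : (ULift.{u} {x : X // ‖x‖ ≤ 1}) => s.down.1) (fun s => s.down.2)
  refine ⟨f, fun x => ?_⟩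
  -- Adding `1` keeps the scalar nonzero when `x = 0`.
  let c : ℂ := (‖x‖ + 1 : ℝ)
  have hc : ‖c‖ = ‖x‖ + 1 := by rw [Complex.norm_real, Real.norm_of_nonneg (by positivity)]
  have hc0 : c ≠ 0 := norm_ne_zero_iff.1 (by rw [hc]; positivity)
  have hx : ‖c⁻¹ • x‖ ≤ 1 := by
    rw [norm_smul, norm_inv, hc, inv_mul_le_one₀ (by positivity)]
    linarith
  refine ⟨c • l1Unit ⟨c⁻¹ • x, hx⟩, ?_⟩
  refine (map_smul (toCLM f) _ _).trans ?_
  refine (congrArg (c • ·) (hf _)).trans ?_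
  exact smul_inv_smul₀ hc0 x

end

/-! ### Nuclear operators and `ℓ¹` -/

/-- A nuclear operator `f : X ⟶ X'` factors `Hom(ℓ¹(S), X ⊗̂ B) ⟶ Hom(ℓ¹(S), X' ⊗̂ B)` through
`Hom(ℓ¹(S × ℕ), B)`, naturally in `B`. -/
lemma IsNuclearMap.exists_factor {X X' : Ban.{u}} {f : X ⟶ X'} (hf : IsNuclearMap f) (S : Type u) :
    ∃ (α : ∀ B : Ban.{u}, (l1 S ⟶ (tensorBan.obj X).obj B) → (l1 (S × ℕ) ⟶ B))
      (β : ∀ B : Ban.{u}, (l1 (S × ℕ) ⟶ B) → (l1 S ⟶ (tensorBan.obj X').obj B)),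
      (∀ (B B' : Ban.{u}) (s : B ⟶ B') (φ : l1 S ⟶ (tensorBan.obj X).obj B),
        α B' (φ ≫ tensorMap (𝟙 X) s) = α B φ ≫ s) ∧
      (∀ (B B' : Ban.{u}) (s : B ⟶ B') (ψ : l1 (S × ℕ) ⟶ B),
        β B' (ψ ≫ s) = β B ψ ≫ tensorMap (𝟙 X') s) ∧
      ∀ (B : Ban.{u}) (φ : l1 S ⟶ (tensorBan.obj X).obj B), β B (α B φ) = φ ≫ tensorMap f (𝟙 B) := by
  obtain ⟨c, ξ, y, hc, hξ, hy, hf⟩ := hf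
  obtain ⟨A, hA⟩ := hξ.exists_norm_le
  obtain ⟨D, hD⟩ := hy.exists_norm_le
  replace hA (n) : ‖ξ n‖ ≤ A := hA _ ⟨n, rfl⟩
  replace hD (n) : ‖y n‖ ≤ D := hD _ ⟨n, rfl⟩
  -- `α B φ` sends the unit vector at `(s, n)` to the contraction of `φ(s)` with `ξ n`; this family
  -- is bounded.
  have hα (B : Ban.{u}) (φ : l1 S ⟶ (tensorBan.obj X).obj B) (s : S × ℕ) :
      ‖contractLeft (ξ s.2) B (φ (l1Unit s.1))‖ ≤ A * ‖toCLM φ‖ := by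
    refine (ContinuousLinearMap.le_of_opNorm_le _ ((norm_contractLeft_le _ _).trans (hA _))
      _).trans ?_
    gcongr
    · exact (norm_nonneg _).trans (hA 0)
    · refine ((toCLM φ).le_opNorm _).trans_eq ?_
      rw [norm_l1Unit, mul_one]
  choose α hα using fun (B : Ban.{u}) (φ : l1 S ⟶ (tensorBan.obj X).obj B) =>
    exists_l1_lift _ (hα B φ)
  -- `β B ψ` sends the unit vector at `s` to `∑ₙ c n • (y n ⊗ ψ(s, n))`; summability of `c` bounds
  -- the sums uniformly in `s`.
  have hβ' (B : Ban.{u}) (ψ : l1 (S × ℕ) ⟶ B) (s : S) (n : ℕ) :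
      ‖c n • tprodLeft (y n) B (ψ (l1Unit (s, n)))‖ ≤ ‖c n‖ * (D * ‖toCLM ψ‖) := by
    rw [norm_smul]
    gcongr
    refine (ContinuousLinearMap.le_of_opNorm_le _ ((norm_tprodLeft_le _ _).trans (hD _))
      _).trans ?_
    gcongr
    · exact (norm_nonneg _).trans (hD 0)
    · refine ((toCLM ψ).le_opNorm _).trans_eq ?_
      rw [norm_l1Unit, mul_one]
  have hβs (B : Ban.{u}) (ψ : l1 (S × ℕ) ⟶ B) (s : S) :
      Summable fun n => c n • tprodLeft (y n) B (ψ (l1Unit (s, n))) :=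
    Summable.of_norm_bounded (hc.norm.mul_right _) (hβ' B ψ s)
  choose β hβ using fun (B : Ban.{u}) (ψ : l1 (S × ℕ) ⟶ B) =>
    exists_l1_lift (X := completion (projSeminorm X' B)) _
      fun s => tsum_of_norm_bounded (hc.norm.mul_right _).hasSum (hβ' B ψ s)
  refine ⟨α, β, fun B B' s φ => l1_hom_ext fun i => ?_, fun B B' s ψ => l1_hom_ext fun i => ?_,
    fun B φ => l1_hom_ext fun i => ?_⟩
  · rw [hα, tensorMap_eq]
    change contractLeft (ξ i.2) B' (projMap (𝟙 X) s (φ _)) = s (α B φ _)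
    rw [hα]
    exact DFunLike.congr_fun (tensor_clm_ext (f := (contractLeft (ξ i.2) B').comp
      (toCLM (projMap (𝟙 X) s))) (g := (toCLM s).comp (contractLeft (ξ i.2) B)) fun x b => by
        change contractLeft _ _ (projMap (𝟙 X) s (tprod x b)) = toCLM s (contractLeft _ _ _)
        rw [projMap_tprod, contractLeft_tprod, contractLeft_tprod, map_smul]
        rfl) _
  · rw [hβ, tensorMap_eq]
    change _ = toCLM (projMap (𝟙 X') s) (β B ψ _)
    rw [hβ, (toCLM (projMap (𝟙 X') s)).map_tsum (hβs B ψ i)]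
    refine tsum_congr fun n => ?_
    rw [map_smul]
    refine congrArg _ ?_
    change tprod (y n) (s _) = projMap (𝟙 X') s (tprod (y n) _)
    rw [projMap_tprod]
    rfl
  · rw [hβ, tensorMap_eq]
    simp only [hα]
    exact (hasSum_projMap hc hA hD hf B _).tsum_eq

/-! ### Kernels and cokernels of Banach spaces -/

section

variable {X Y : Ban.{u}} (f : X ⟶ Y)

/-- The kernel of a bounded operator. -/
def banKer : Ban.{u} := Ban.mk (LinearMap.ker (toCLM f).toLinearMap)

def banKerι : banKer f ⟶ X := (LinearMap.ker (toCLM f).toLinearMap).subtypeL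

lemma banKer_condition : banKerι f ≫ f = 0 :=
  ContinuousLinearMap.ext fun x => x.2

def isLimitBanKer : IsLimit (KernelFork.ofι (banKerι f) (banKer_condition f)) :=
  KernelFork.IsLimit.ofι _ _
    (fun g hg => (toCLM g).codRestrict _ fun x => DFunLike.congr_fun (F := _ →L[ℂ] _) hg x)
    (fun _ _ => ContinuousLinearMap.ext fun _ => rfl)
    fun _ _ _ h => ContinuousLinearMap.ext fun x =>
      Subtype.ext (DFunLike.congr_fun (F := _ →L[ℂ] _) h x)

instance : HasKernels Ban.{u} := ⟨fun f => ⟨⟨_, isLimitBanKer f⟩⟩⟩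

/-- The closure of the range of a bounded operator. -/
def banClosedRange : Submodule ℂ Y := (LinearMap.range (toCLM f).toLinearMap).topologicalClosure

instance : IsClosed (banClosedRange f : Set Y) := Submodule.isClosed_topologicalClosure _

/-- The cokernel of a bounded operator. -/
def banCoker : Ban.{u} := Ban.mk (Y ⧸ banClosedRange f)

def banCokerπ : Y ⟶ banCoker f := (banClosedRange f).mkQL

lemma banCokerπ_surjective : Function.Surjective (banCokerπ f) :=
  Submodule.Quotient.mk_surjective _

lemma banCoker_condition : f ≫ banCokerπ f = 0 :=
  ContinuousLinearMap.ext fun x => (Submodule.Quotient.mk_eq_zero _).2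
    (Submodule.le_topologicalClosure _ ⟨x, rfl⟩)

lemma banClosedRange_le {Z : Ban.{u}} (g : Y ⟶ Z) (hg : f ≫ g = 0) :
    banClosedRange f ≤ (toCLM g).ker := by
  refine Submodule.topologicalClosure_minimal _ ?_ (toCLM g).isClosed_ker
  rintro _ ⟨x, rfl⟩
  exact DFunLike.congr_fun (F := _ →L[ℂ] _) hg x

def isColimitBanCoker : IsColimit (CokernelCofork.ofπ (banCokerπ f) (banCoker_condition f)) :=
  CokernelCofork.IsColimit.ofπ _ _
    (fun g hg => (banClosedRange f).liftQL (toCLM g) (banClosedRange_le f g hg))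
    (fun _ _ => ContinuousLinearMap.ext fun _ => rfl)
    fun g _ m h => ContinuousLinearMap.ext fun x => by
      obtain ⟨y, rfl⟩ := banCokerπ_surjective f x
      exact DFunLike.congr_fun (F := _ →L[ℂ] _) h y

instance : HasCokernels Ban.{u} := ⟨fun f => ⟨⟨_, isColimitBanCoker f⟩⟩⟩

instance : HasEqualizers Ban.{u} := Preadditive.hasEqualizers_of_hasKernels
instance : HasCoequalizers Ban.{u} := Preadditive.hasCoequalizers_of_hasCokernels

instance : (ULiftHom.down : BanLift.{w, u} ⥤ Ban.{u}).IsEquivalence :=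
  ULiftHom.equiv.isEquivalence_inverse

instance : HasEqualizers BanLift.{w, u} :=
  Adjunction.hasLimitsOfShape_of_equivalence (ULiftHom.down : BanLift.{w, u} ⥤ Ban.{u})

instance : HasCoequalizers BanLift.{w, u} :=
  Adjunction.hasColimitsOfShape_of_equivalence (ULiftHom.down : BanLift.{w, u} ⥤ Ban.{u})

/-- Coequalizers of Banach spaces are surjective. -/
lemma surjective_of_isColimit {g : X ⟶ Y} {c : Cofork f g} (hc : IsColimit c) :
    Function.Surjective c.π := by
  -- The coequalizer is a retract of the concrete quotient by the closed range of `f - g`,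
  -- compatibly with the maps from `Y`.
  have h : f ≫ banCokerπ (f - g) = g ≫ banCokerπ (f - g) := by
    rw [← sub_eq_zero, ← Preadditive.sub_comp, banCoker_condition]
  obtain ⟨l, hl⟩ := Cofork.IsColimit.desc' hc _ h
  have h' : (f - g) ≫ c.π = 0 := by
    rw [Preadditive.sub_comp, c.condition, sub_self]
  obtain ⟨m, hm⟩ := CokernelCofork.IsColimit.desc' (isColimitBanCoker (f - g)) _ h'
  have hlm : l ≫ m = 𝟙 _ := Cofork.IsColimit.hom_ext hc (by
    rw [← Category.assoc, hl]
    exact hm.trans (Category.comp_id _).symm)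
  intro z
  obtain ⟨y, hy⟩ := banCokerπ_surjective (f - g) (l z)
  refine ⟨y, ?_⟩
  calc c.π y = m (banCokerπ (f - g) y) := (DFunLike.congr_fun (F := _ →L[ℂ] _) hm y).symm
    _ = m (l z) := by rw [hy]
    _ = z := DFunLike.congr_fun (F := _ →L[ℂ] _) hlm z

/-- A surjective operator is the cokernel of its kernel. -/
def isColimitOfSurjective (hf : Function.Surjective f) :
    IsColimit (CokernelCofork.ofπ f (banKer_condition f)) := by
  -- By the open mapping theorem `f` is a topological quotient map, so the algebraic factorizations
  -- through `X / ker f` are continuous.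
  have hq : Topology.IsQuotientMap (toCLM f) := (toCLM f).isQuotientMap hf
  have hle {Z : Ban.{u}} (g : X ⟶ Z) (hg : banKerι f ≫ g = 0) :
      (toCLM f).toLinearMap.ker ≤ (toCLM g).toLinearMap.ker :=
    fun x hx => LinearMap.mem_ker.2 (DFunLike.congr_fun (F := banKer f →L[ℂ] Z) hg ⟨x, hx⟩)
  have happ {Z : Ban.{u}} (g : X ⟶ Z) (hg : banKerι f ≫ g = 0) (x : X) :
      (Submodule.liftQ _ (toCLM g).toLinearMap (hle g hg))
        (((toCLM f).toLinearMap.quotKerEquivOfSurjective hf).symm (f x)) = g x := by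
    have : ((toCLM f).toLinearMap.quotKerEquivOfSurjective hf).symm (f x) =
        Submodule.Quotient.mk x :=
      (LinearEquiv.symm_apply_eq _).2 rfl
    rw [this]
    rfl
  exact CokernelCofork.IsColimit.ofπ _ _
    (fun {Z} g hg =>
      { toLinearMap := (Submodule.liftQ _ (toCLM g).toLinearMap (hle g hg)).comp
          ((toCLM f).toLinearMap.quotKerEquivOfSurjective hf).symm.toLinearMap
        cont := hq.continuous_iff.2 (((toCLM g).continuous).congr fun x => (happ g hg x).symm) })
    (fun g hg => ContinuousLinearMap.ext fun x => happ g hg x)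
    fun g hg m h => ContinuousLinearMap.ext fun y => by
      obtain ⟨x, rfl⟩ := hf y
      exact (DFunLike.congr_fun (F := X →L[ℂ] _) h x).trans (happ g hg x).symm

end

/-! ### Strict epimorphisms of ind-objects -/

instance : PreservesFiniteColimits constInd.{w, u} := by
  unfold constInd
  infer_instance

/-- Morphisms from the spaces `ℓ¹(S)` lift through `e`. -/
def LiftsL1 {X Y : IndBan.{w, u}} (e : X ⟶ Y) : Prop :=
  ∀ (S : Type u) (t : constInd.obj (l1 S) ⟶ Y), ∃ s : constInd.obj (l1 S) ⟶ X, s ≫ e = t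

section

variable {I : Type max u w} [SmallCategory I] [IsFiltered I]

/-- The canonical morphism from a term of an inductive system to its ind-object. -/
def indLimι (D : I ⥤ BanLift.{w, u}) (j : I) :
    constInd.{w, u}.obj (ULiftHom.down.obj (D.obj j)) ⟶ (Ind.lim I).obj D :=
  colimit.ι (D ⋙ Ind.yoneda) j

lemma indLimι_naturality {D D' : I ⥤ BanLift.{w, u}} (θ : D ⟶ D') (j : I) :
    indLimι D j ≫ (Ind.lim I).map θ =
      constInd.map (ULiftHom.down.map (θ.app j)) ≫ indLimι D' j :=
  ι_colimMap _ _

lemma indLimι_w (D : I ⥤ BanLift.{w, u}) {j k : I} (h : j ⟶ k) :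
    constInd.map (ULiftHom.down.map (D.map h)) ≫ indLimι D k = indLimι D j :=
  colimit.w (D ⋙ Ind.yoneda) h

lemma exists_map_indLimι {D : I ⥤ BanLift.{w, u}} {T : Ban.{u}}
    (t : constInd.obj T ⟶ (Ind.lim I).obj D) :
    ∃ (j : I) (φ : T ⟶ ULiftHom.down.obj (D.obj j)), constInd.map φ ≫ indLimι D j = t := by
  obtain ⟨j, u, hu⟩ := exists_factor_of_isColimit (colimit.isColimit (D ⋙ Ind.yoneda)) T t
  obtain ⟨φ, rfl⟩ : ∃ φ : T ⟶ ULiftHom.down.obj (D.obj j), constInd.map φ = u :=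
    constInd.map_surjective u
  exact ⟨j, φ, hu⟩

end

/-- A cokernel in `Ind(Ban)` can be computed levelwise over one filtered category; each level is
then a surjective operator, and `t` lives at one level. -/
lemma liftsL1_of_normalEpi {X Y : IndBan.{w, u}} (e : X ⟶ Y) (he : NormalEpi e) : LiftsL1 e := by
  intro S t
  -- The levelwise representative of `0` need not be `0`, so the levels are coequalizers rather than
  -- cokernels.
  obtain ⟨P⟩ := nonempty_indParallelPairPresentation he.W.isIndObject_inclusion_obj
    X.isIndObject_inclusion_obj ((Ind.inclusion _).map he.g) ((Ind.inclusion _).map 0)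
  let α := P.parallelPairIsoParallelPairCompIndYoneda
  let π := coequalizer.π P.φ P.ψ
  let hc := coequalizerIsCoequalizer P.φ P.ψ
  have hc' := isColimitOfPreserves (Ind.lim P.I) hc
  let i : Y ≅ (Ind.lim P.I).obj (coequalizer P.φ P.ψ) :=
    IsColimit.coconePointsIsoOfNatIso he.isColimit hc' α
  let β : X ≅ (Ind.lim P.I).obj P.F₂ := α.app WalkingParallelPair.one
  have hi : e ≫ i.hom = β.hom ≫ (Ind.lim P.I).map π :=
    IsColimit.comp_coconePointsIsoOfNatIso_hom he.isColimit hc' α WalkingParallelPair.one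
  have hsurj (j : P.I) : Function.Surjective (ULiftHom.down.map (π.app j)) :=
    surjective_of_isColimit _ (isColimitCoforkMapOfIsColimit
      ((evaluation P.I BanLift.{w, u}).obj j ⋙ ULiftHom.down) _ hc)
  obtain ⟨j, φ, hφ⟩ := exists_map_indLimι (t ≫ i.hom)
  obtain ⟨ψ, rfl⟩ := exists_l1_lift_of_surjective _ (hsurj j) φ
  refine ⟨(constInd.map ψ ≫ indLimι P.F₂ j) ≫ β.inv, ?_⟩
  rw [← cancel_mono i.hom, ← hφ, Category.assoc, Category.assoc, hi, Iso.inv_hom_id_assoc,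
    Category.assoc, indLimι_naturality, Functor.map_comp, Category.assoc]

instance : HasKernels IndBan.{w, u} := inferInstance

/-- A compatible family of maps on morphisms from constant ind-objects is induced by a
morphism. -/
lemma exists_desc_constInd {F G : IndBan.{w, u}}
    (m : ∀ T : Ban.{u}, (constInd.{w, u}.obj T ⟶ F) → (constInd.{w, u}.obj T ⟶ G))
    (h : ∀ (T T' : Ban.{u}) (f : T ⟶ T') (t : constInd.obj T' ⟶ F),
      m T (constInd.map f ≫ t) = constInd.map f ≫ m T' t) :
    ∃ d : F ⟶ G, ∀ (T : Ban.{u}) (t : constInd.obj T ⟶ F), t ≫ d = m T t := by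
  let c : Cocone (CostructuredArrow.proj constInd.{w, u} F ⋙ constInd) :=
    { pt := G
      ι :=
        { app x := m x.left x.hom
          naturality x y f :=
            ((h x.left y.left f.left y.hom).symm.trans
              (congrArg (m x.left) (CostructuredArrow.w f))).trans (Category.comp_id _).symm } }
  exact ⟨(constInd.denseAt F).desc c, fun T t =>
    (congrArg (· ≫ _) (Category.id_comp t)).symm.trans
      ((constInd.denseAt F).fac c (constOver t))⟩

section

variable {P F G : IndBan.{w, u}} (e : P ⟶ F) (he : LiftsL1 e)

/-- A surjective operator is the cokernel of its kernel, and `constInd` preserves finite colimits.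
-/
lemma exists_desc_of_surjective {T L : Ban.{u}} (p : L ⟶ T) (hp : Function.Surjective p)
    (m : constInd.obj L ⟶ G) (hm : constInd.map (banKerι p) ≫ m = 0) :
    ∃ m' : constInd.obj T ⟶ G, constInd.map p ≫ m' = m :=
  ⟨_, (CokernelCofork.IsColimit.desc' (isColimitCoforkMapOfIsColimit' constInd.{w, u}
    (banKer_condition p) (isColimitOfSurjective p hp)) m hm).2⟩

lemma epi_constInd_map {T L : Ban.{u}} (p : L ⟶ T) (hp : Function.Surjective p) :
    Epi (constInd.{w, u}.map p) :=
  Cofork.IsColimit.epi (isColimitCoforkMapOfIsColimit' constInd.{w, u}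
    (banKer_condition p) (isColimitOfSurjective p hp))

include he in
-- Cover `T` by some `ℓ¹`, lift through `e` and apply `φ`. Two lifts differ by an element of `ker
-- e`, which `φ` kills, so the result descends to `T`. Quantifying over all `q` characterizes `m`
-- independently of the cover.
lemma exists_desc_const (φ : P ⟶ G) (hφ : kernel.ι e ≫ φ = 0) {T : Ban.{u}}
    (t : constInd.obj T ⟶ F) :
    ∃ m : constInd.obj T ⟶ G, ∀ (S : Type u) (q : l1 S ⟶ T) (s : constInd.obj (l1 S) ⟶ P),
      s ≫ e = constInd.map q ≫ t → constInd.map q ≫ m = s ≫ φ := by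
  have key {A : IndBan.{w, u}} (a : A ⟶ P) (ha : a ≫ e = 0) : a ≫ φ = 0 := by
    rw [← kernel.lift_ι e a ha, Category.assoc, hφ, comp_zero]
  obtain ⟨p, hp⟩ := exists_l1_surjective T
  obtain ⟨s, hs⟩ := he _ (constInd.map p ≫ t)
  obtain ⟨m, hm⟩ := exists_desc_of_surjective p hp (s ≫ φ) (by
    rw [← Category.assoc]
    apply key
    rw [Category.assoc, hs, ← Category.assoc, ← Functor.map_comp, banKer_condition,
      Functor.map_zero, zero_comp])
  refine ⟨m, fun S q s' hs' => ?_⟩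
  -- Once `q` factors as `q' ≫ p`, both `q' ≫ s` and `s'` are lifts of the same element.
  obtain ⟨q', rfl⟩ := exists_l1_lift_of_surjective p hp q
  rw [Functor.map_comp, Category.assoc, hm, ← Category.assoc, ← sub_eq_zero,
    ← Preadditive.sub_comp]
  apply key
  rw [Preadditive.sub_comp, hs', Category.assoc, hs, Functor.map_comp, Category.assoc, sub_self]

include he in
/-- A morphism which lifts morphisms from the spaces `ℓ¹(S)` is the cokernel of its kernel. -/
lemma nonempty_normalEpi_of_liftsL1 : Nonempty (NormalEpi e) := by
  have hext {T : Ban.{u}} {A : IndBan.{w, u}} {a b : constInd.obj T ⟶ A}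
      (h : ∀ (S : Type u) (p : l1 S ⟶ T), constInd.map p ≫ a = constInd.map p ≫ b) : a = b := by
    obtain ⟨p, hp⟩ := exists_l1_surjective T
    have := epi_constInd_map.{w, u} p hp
    exact (cancel_epi (constInd.map p)).1 (h _ p)
  have hdesc {G : IndBan.{w, u}} (φ : P ⟶ G) (hφ : kernel.ι e ≫ φ = 0) :
      ∃ m : F ⟶ G, e ≫ m = φ := by
    choose m hm using fun T t => exists_desc_const e he φ hφ (T := T) t
    -- The characterization of `m` on maps from `ℓ¹` spaces forces naturality in `T`, and density
    -- glues the family.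
    obtain ⟨d, hd⟩ := exists_desc_constInd m fun T T' f t => hext fun S p => by
      obtain ⟨s, hs⟩ := he S (constInd.map p ≫ constInd.map f ≫ t)
      rw [hm _ _ _ _ _ hs, ← Category.assoc, ← Functor.map_comp, hm _ t S (p ≫ f) s]
      rw [hs, Functor.map_comp, Category.assoc]
    refine ⟨d, hom_ext_of_constInd fun T t => hext fun S p => ?_⟩
    rw [← Category.assoc t, hd, hm _ _ S p (constInd.map p ≫ t) (Category.assoc _ _ _),
      Category.assoc]
  have hepi : Epi e := by
    refine ⟨fun {G} a b h => hom_ext_of_constInd fun T t => hext fun S p => ?_⟩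
    obtain ⟨s, hs⟩ := he S (constInd.map p ≫ t)
    rw [← Category.assoc, ← hs, Category.assoc, h, ← Category.assoc, hs, Category.assoc]
  choose d hd using @hdesc
  exact ⟨⟨kernel e, kernel.ι e, kernel.condition e, CokernelCofork.IsColimit.ofπ _ _
    (fun φ hφ => d φ hφ) (fun φ hφ => hd φ hφ)
    fun φ hφ m hm => (cancel_epi e).1 (hm.trans (hd φ hφ).symm)⟩⟩

end

/-- Strict exactness is exactness after applying `Hom("ℓ¹(S)", -)` for all `S`. -/
lemma isStrictlyExact_iff (K : ShortComplex IndBan.{w, u}) :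
    IsStrictlyExact K ↔ ∀ (S : Type u) (t : constInd.obj (l1 S) ⟶ K.X₂), t ≫ K.g = 0 →
      ∃ s : constInd.obj (l1 S) ⟶ K.X₁, s ≫ K.f = t := by
  constructor
  · rintro ⟨Z, e, i, hi, hei, ⟨he⟩, ⟨hl⟩⟩ S t ht
    obtain ⟨t', ht'⟩ := KernelFork.IsLimit.lift' hl t ht
    obtain ⟨s, hs⟩ := liftsL1_of_normalEpi e he S t'
    refine ⟨s, ?_⟩
    rw [← hei, ← Category.assoc, hs]
    exact ht'
  · intro h
    -- Exactness on `ℓ¹` elements says that the corestriction of `K.f` to the kernel satisfies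
    -- `LiftsL1`.
    refine ⟨kernel K.g, kernel.lift K.g K.f K.zero, kernel.ι K.g, kernel.condition _,
      kernel.lift_ι _ _ _, nonempty_normalEpi_of_liftsL1 _ fun S t => ?_,
      ⟨kernelIsKernel K.g⟩⟩
    obtain ⟨s, hs⟩ := h S (t ≫ kernel.ι K.g) (by rw [Category.assoc, kernel.condition, comp_zero])
    exact ⟨s, by rw [← cancel_mono (kernel.ι K.g), Category.assoc, kernel.lift_ι, hs]⟩

/-! ### Projective objects -/

lemma isStrictlyProjective_l1 (S : Type u) :
    IsStrictlyProjective (constInd.{w, u}.obj (l1 S)) :=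
  fun _ _ e he t => liftsL1_of_normalEpi e he.some S t

lemma isStrictlyProjective_sigma {J : Type max u w} (Q : J → IndBan.{w, u})
    (h : ∀ j, IsStrictlyProjective (Q j)) : IsStrictlyProjective (∐ Q) := by
  intro X Y e he f
  choose g hg using fun j => h j e he (Sigma.ι Q j ≫ f)
  exact ⟨Sigma.desc g, Sigma.hom_ext _ _ fun j => by
    rw [← Category.assoc, Sigma.ι_desc, hg]⟩

/-- There are enough projective objects in `Ind(Ban)`. -/
lemma exists_projective_cover (F : IndBan.{w, u}) :
    ∃ (P : IndBan.{w, u}) (e : P ⟶ F), IsStrictlyProjective P ∧ LiftsL1 e := by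
  choose p hp using fun j => exists_l1_surjective ((presentationDiagram F).obj j)
  -- The cover is the direct sum, over the stages of a presentation, of the `ℓ¹` spaces on their
  -- unit balls.
  let Q (j : F.presentation.I) : IndBan.{w, u} := constInd.obj
    (l1 (ULift.{u} {x : (presentationDiagram F).obj j // ‖x‖ ≤ 1}))
  refine ⟨∐ Q, Sigma.desc fun j => constInd.map (p j) ≫ (presentationCocone F).ι.app j,
    isStrictlyProjective_sigma _ fun j => isStrictlyProjective_l1 _, fun S t => ?_⟩
  obtain ⟨j, u, rfl⟩ := exists_factor_of_isColimit (isColimitPresentationCocone F) (l1 S) t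
  obtain ⟨φ, rfl⟩ := constInd.map_surjective u
  obtain ⟨ψ, rfl⟩ := exists_l1_lift_of_surjective _ (hp j) φ
  refine ⟨constInd.map ψ ≫ Sigma.ι Q j, ?_⟩
  rw [Category.assoc, Sigma.ι_desc, Functor.map_comp]
  exact (Category.assoc _ _ _).symm

/-! ### Tensor products with nuclear ind-objects are exact -/

section

variable {E F G : IndBan.{w, u}}

/-- The canonical morphism `"X i" ⟶ "lim" X`. -/
def toIndLim {I : Type max u w} [SmallCategory I] [IsFiltered I] (X : I ⥤ Ban.{u}) (i : I) :
    constInd.{w, u}.obj (X.obj i) ⟶ indLim.{w, u} X :=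
  indLimι (X ⋙ ULiftHom.up) i

lemma toIndLim_w {I : Type max u w} [SmallCategory I] [IsFiltered I] (X : I ⥤ Ban.{u}) {i j : I}
    (h : i ⟶ j) : constInd.{w, u}.map (X.map h) ≫ toIndLim.{w, u} X j = toIndLim X i :=
  indLimι_w (X ⋙ ULiftHom.up) h

lemma exists_map_toIndLim {I : Type max u w} [SmallCategory I] [IsFiltered I] {X : I ⥤ Ban.{u}}
    {T : Ban.{u}} (t : constInd.obj T ⟶ indLim.{w, u} X) :
    ∃ (i : I) (φ : T ⟶ X.obj i), constInd.map φ ≫ toIndLim X i = t :=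
  exists_map_indLimι t

/-- Presentation-free form of nuclearity: `x` factors through a stage, and precomposing a nuclear
transition operator with a bounded one keeps it nuclear. -/
lemma IsNuclear.exists_nuclearMap (hE : IsNuclear E) {T : Ban.{u}} (x : constInd.obj T ⟶ E) :
    ∃ (Y : Ban.{u}) (f : T ⟶ Y) (y : constInd.obj Y ⟶ E),
      IsNuclearMap f ∧ constInd.map f ≫ y = x := by
  obtain ⟨I, _, _, _, X, hX, ⟨e⟩⟩ := hE
  obtain ⟨i, φ, hφ⟩ := exists_map_toIndLim (x ≫ e.hom)
  obtain ⟨j, hij, c, ξ, y, hc, hξ, hy, h⟩ := hX i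
  refine ⟨X.obj j, φ ≫ X.map (homOfLE hij), toIndLim X j ≫ e.inv,
    ⟨c, fun n => (ξ n).comp (toCLM φ), y, hc, ?_, hy, fun t => h (φ t)⟩, ?_⟩
  · obtain ⟨C, hC⟩ := hξ.exists_norm_le
    refine (isBounded_iff_forall_norm_le).2 ⟨C * ‖toCLM φ‖, ?_⟩
    rintro _ ⟨n, rfl⟩
    refine (ContinuousLinearMap.opNorm_comp_le _ _).trans ?_
    exact mul_le_mul_of_nonneg_right (hC _ ⟨n, rfl⟩) (norm_nonneg _)
  · rw [← cancel_mono e.hom, ← hφ, Category.assoc, Category.assoc, e.inv_hom_id,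
      Category.comp_id, ← toIndLim_w _ (homOfLE hij), ← Category.assoc, ← Functor.map_comp]

lemma tensorMap_comp {X X' X'' B B' B'' : Ban.{u}} (f : X ⟶ X') (f' : X' ⟶ X'') (s : B ⟶ B')
    (s' : B' ⟶ B'') : tensorMap f s ≫ tensorMap f' s' = tensorMap (f ≫ f') (s ≫ s') := by
  rw [tensorMap_eq, tensorMap_eq, tensorMap_eq]
  exact (projMap_comp _ _ _ _).symm

lemma tensorMap_add {X Y B B' : Ban.{u}} (f : X ⟶ Y) (s s' : B ⟶ B') :
    tensorMap f (s + s') = tensorMap f s + tensorMap f s' := by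
  rw [tensorMap_eq, tensorMap_eq, tensorMap_eq]
  refine tensor_clm_ext (f := toCLM (projMap f (s + s')))
    (g := toCLM (projMap f s) + toCLM (projMap f s')) fun x b => ?_
  change projMap f (s + s') (tprod x b) = projMap f s (tprod x b) + projMap f s' (tprod x b)
  rw [projMap_tprod, projMap_tprod, projMap_tprod]
  change toCompletion _ (f x ⊗ₜ[ℂ] (s b + s' b)) = _
  rw [TensorProduct.tmul_add, map_add]
  rfl

lemma toTensor_comp_right {X B B' : Ban.{u}} (x : constInd.obj X ⟶ E) (s : B ⟶ B')
    (t : constInd.obj B' ⟶ F) :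
    toTensor x (constInd.map s ≫ t) = constInd.map (tensorMap (𝟙 X) s) ≫ toTensor x t := by
  rw [← toTensor_comp, CategoryTheory.Functor.map_id, Category.id_comp]

lemma toTensor_comp_left {X X' B : Ban.{u}} (f : X ⟶ X') (x : constInd.obj X' ⟶ E)
    (t : constInd.obj B ⟶ F) :
    toTensor (constInd.map f ≫ x) t = constInd.map (tensorMap f (𝟙 B)) ≫ toTensor x t := by
  rw [← toTensor_comp, CategoryTheory.Functor.map_id, Category.id_comp]

lemma toTensor_add {X B : Ban.{u}} (x : constInd.obj X ⟶ E) (t t' : constInd.obj B ⟶ F) :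
    toTensor x (t + t') = toTensor x t + toTensor x t' := by
  obtain ⟨C, q, a, b, rfl, rfl⟩ := exists_common_constInd t t'
  rw [← Preadditive.add_comp, ← Functor.map_add, toTensor_comp_right, toTensor_comp_right,
    toTensor_comp_right, tensorMap_add, Functor.map_add, Preadditive.add_comp]

/-- Additivity is needed to act on homotopy categories. It reduces to operators `tensorMap (𝟙 X) s`,
after two elements are brought to a common stage. -/
instance : ((tensorInd.{w, u}).obj E).Additive where
  map_add {F G u v} := tensorInd_hom_ext fun X B x t => by
    rw [toTensor_naturality, Preadditive.comp_add, Preadditive.comp_add, toTensor_add,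
      toTensor_naturality, toTensor_naturality]

/-- The tensor product with a nuclear ind-object preserves strictly exact complexes. -/
lemma IsNuclear.isStrictlyExact_map (hE : IsNuclear E) {K : ShortComplex IndBan.{w, u}}
    (hK : IsStrictlyExact K) : IsStrictlyExact (K.map (tensorInd.obj E)) := by
  rw [isStrictlyExact_iff] at hK ⊢
  intro S u hu
  obtain ⟨X, B, x, t, φ, hφ⟩ := exists_eq_map_toTensor (F := K.X₂) u
  have h0 : constInd.map φ ≫ toTensor x (t ≫ K.g) = 0 := by
    rw [← toTensor_naturality, ← Category.assoc, ← hφ]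
    exact hu
  -- The cycle condition holds at a Banach stage; `s : B ⟶ B'` represents `K.g` restricted to `B`.
  obtain ⟨X', B', x', t', f, s, rfl, hs, hfs⟩ := exists_of_map_toTensor_eq_zero _ _ _ h0
  obtain ⟨Y, n, y, hn, rfl⟩ := hE.exists_nuclearMap x'
  obtain ⟨α, β, hα, hβ, hαβ⟩ := hn.exists_factor S
  let φ' := φ ≫ tensorMap f (𝟙 B)
  -- Naturality of `α` transports the cycle condition from the tensor product to `B`.
  have hα0 : α B φ' ≫ s = 0 := by
    rw [← hα, Category.assoc, tensorMap_comp, Category.comp_id, Category.id_comp, hfs]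
    -- `α` is not given as a linear map; naturality along the zero operator yields `α 0 = 0`.
    have := hα B' B' 0 0
    rwa [zero_comp, comp_zero] at this
  obtain ⟨v, hv⟩ := hK (S × ℕ) (constInd.map (α B φ') ≫ t) (by
    rw [Category.assoc, ← hs, ← Category.assoc, ← Functor.map_comp, hα0, Functor.map_zero,
      zero_comp])
  -- The equality of `v ≫ K.f` with the contracted cycle is realized as an equality of operators
  -- into one Banach space.
  obtain ⟨C, q, a, b, ha, hb⟩ := exists_common_constInd (v ≫ K.f) t
  obtain ⟨C', q', r, rfl, hr⟩ := exists_eq_of_constInd q a (α B φ' ≫ b) (by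
    rw [Functor.map_comp, Category.assoc, ha, hb, hv])
  rw [← Category.assoc, ← Functor.map_comp] at ha hb
  -- By naturality `β` is determined by the universal element `β (𝟙) : ℓ¹(S) ⟶ Y ⊗̂ ℓ¹(S × ℕ)`; the
  -- required lift is this element followed by `toTensor y v`.
  have hβ' : β _ (𝟙 _) ≫ tensorMap (𝟙 Y) (a ≫ r) =
      φ ≫ tensorMap (f ≫ n) (𝟙 B) ≫ tensorMap (𝟙 Y) (b ≫ r) := by
    rw [← hβ, Category.id_comp, hr, Category.assoc, hβ, hαβ, Category.assoc, Category.assoc,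
      ← Category.assoc (tensorMap f _), tensorMap_comp, Category.id_comp]
  have main : (constInd.map (β _ (𝟙 _)) ≫ toTensor y v) ≫ (tensorInd.obj E).map K.f =
      constInd.map φ ≫ toTensor (constInd.map f ≫ constInd.map n ≫ y) t := by
    rw [Category.assoc, toTensor_naturality, ← ha, toTensor_comp_right, ← Category.assoc,
      ← Functor.map_comp, hβ', Functor.map_comp, Functor.map_comp, Category.assoc, Category.assoc,
      ← toTensor_comp_right, hb, ← toTensor_comp_left, Functor.map_comp, Category.assoc]
  exact ⟨_, main.trans hφ.symm⟩

end

/-! ### The derived tensor product -/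

/-- An additive functor preserving strictly exact complexes preserves the morphisms inverted in
the derived category. -/
lemma trW_mapHomotopyCategory {A B : Type*} [Category* A] [Preadditive A] [HasZeroObject A]
    [HasBinaryBiproducts A] [Category* B] [Preadditive B] [HasZeroObject B] [HasBinaryBiproducts B]
    (T : A ⥤ B) [T.Additive]
    (hT : ∀ K : ShortComplex A, IsStrictlyExact K → IsStrictlyExact (K.map T))
    {X Y : HomotopyCategory A (ComplexShape.up ℤ)} (f : X ⟶ Y) (hf : (strictlyAcyclic A).trW f) :
    (strictlyAcyclic B).trW ((T.mapHomotopyCategory (ComplexShape.up ℤ)).map f) := by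
  rw [ObjectProperty.trW_iff] at hf ⊢
  obtain ⟨Z, g, h, hd, hZ⟩ := hf
  exact ⟨_, _, _, (T.mapHomotopyCategory (ComplexShape.up ℤ)).map_distinguished _ hd,
    fun n => hT _ (hZ n)⟩

/-- The first factor is inverted because its cone stays acyclic; the second identifies single
complexes and is already invertible. -/
theorem isIso_derivedTensorToTensor {E F : IndBan.{w, u}} (hE : IsNuclear E) (P : ProjRes F) :
    IsIso (derivedTensorToTensor E P) := by
  have h := trW_mapHomotopyCategory (tensorInd.obj E) (fun K hK => hE.isStrictlyExact_map hK) _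
    P.isStrictQuasiIso
  have h' : IsIso ((toQDerived IndBan.{w, u}).map
      (((tensorInd.obj E).mapHomologicalComplex (ComplexShape.up ℤ)).map P.ε)) :=
    Localization.inverts (strictlyAcyclic IndBan.{w, u}).trW.Q _ _ h
  unfold derivedTensorToTensor
  rw [Functor.map_comp]
  exact IsIso.comp_isIso' h' inferInstance

/-! ### Existence of projective resolutions -/

section

variable (F : IndBan.{w, u})

/-- A projective object covering `F`. -/
def projCover : IndBan.{w, u} := (exists_projective_cover F).choose

/-- The strict epimorphism from the projective cover of `F`. -/
def projCoverπ : projCover F ⟶ F := (exists_projective_cover F).choose_spec.choose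

lemma isStrictlyProjective_projCover : IsStrictlyProjective (projCover F) :=
  (exists_projective_cover F).choose_spec.choose_spec.1

lemma liftsL1_projCoverπ : LiftsL1 (projCoverπ F) :=
  (exists_projective_cover F).choose_spec.choose_spec.2

/-- The iterated syzygies of `F`. -/
def syzygy : ℕ → IndBan.{w, u}
  | 0 => F
  | n + 1 => kernel (projCoverπ (syzygy n))

/-- The inclusion of a syzygy. -/
def syzygyι (n : ℕ) : syzygy F (n + 1) ⟶ projCover (syzygy F n) :=
  kernel.ι (projCoverπ (syzygy F n))

instance (n : ℕ) : Mono (syzygyι F n) :=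
  inferInstanceAs (Mono (kernel.ι (projCoverπ (syzygy F n))))

lemma syzygyι_comp_π (n : ℕ) : syzygyι F n ≫ projCoverπ (syzygy F n) = 0 :=
  kernel.condition _

/-- The differentials of the projective resolution of `F`, indexed by natural numbers. -/
def syzygyD (n : ℕ) : projCover (syzygy F (n + 1)) ⟶ projCover (syzygy F n) :=
  projCoverπ (syzygy F (n + 1)) ≫ syzygyι F n

lemma syzygyD_comp_π (n : ℕ) : syzygyD F n ≫ projCoverπ (syzygy F n) = 0 := by
  rw [syzygyD, Category.assoc, syzygyι_comp_π, comp_zero]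

lemma syzygyD_comp (n : ℕ) : syzygyD F (n + 1) ≫ syzygyD F n = 0 := by
  rw [syzygyD.eq_1 F n, ← Category.assoc, syzygyD_comp_π, zero_comp]

variable {F}

/-- An element killed by the cover map lies in the next syzygy, whose own cover lifts elements from
`ℓ¹` spaces. -/
lemma exists_syzygyD_of_comp_π {n : ℕ} {S : Type u}
    (t : constInd.obj (l1 S) ⟶ projCover (syzygy F n)) (ht : t ≫ projCoverπ (syzygy F n) = 0) :
    ∃ s, s ≫ syzygyD F n = t := by
  obtain ⟨t', ht'⟩ : ∃ t', t' ≫ syzygyι F n = t := ⟨kernel.lift _ t ht, kernel.lift_ι _ _ _⟩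
  obtain ⟨s, hs⟩ := liftsL1_projCoverπ (syzygy F (n + 1)) S t'
  exact ⟨s, by rw [syzygyD, ← Category.assoc, hs, ht']⟩

lemma exists_syzygyD_of_comp {n : ℕ} {S : Type u}
    (t : constInd.obj (l1 S) ⟶ projCover (syzygy F (n + 1))) (ht : t ≫ syzygyD F n = 0) :
    ∃ s, s ≫ syzygyD F (n + 1) = t := by
  refine exists_syzygyD_of_comp_π t ?_
  rw [← cancel_mono (syzygyι F n), zero_comp, Category.assoc]
  exact ht

variable (F)

/-- The terms of the projective resolution of `F`. -/
def resolutionX : ℤ → IndBan.{w, u}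
  | .ofNat 0 => projCover (syzygy F 0)
  | .ofNat (_ + 1) => 0
  | .negSucc n => projCover (syzygy F (n + 1))

/-- The differentials of the projective resolution of `F`. -/
def resolutionD : ∀ n : ℤ, resolutionX F n ⟶ resolutionX F (n + 1)
  | .ofNat _ => 0
  -- Splitting `negSucc` at `0` lets the index `n + 1` reduce to a constructor, so the types agree
  -- definitionally.
  | .negSucc 0 => syzygyD F 0
  | .negSucc (n + 1) => syzygyD F (n + 1)

lemma resolutionD_comp : ∀ n : ℤ, resolutionD F n ≫ resolutionD F (n + 1) = 0
  | .ofNat _ => zero_comp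
  | .negSucc 0 => comp_zero
  | .negSucc 1 => syzygyD_comp F 0
  | .negSucc (n + 2) => syzygyD_comp F (n + 1)

/-- The projective resolution of `F`. -/
def resolution : CochainComplex IndBan.{w, u} ℤ :=
  CochainComplex.of (resolutionX F) (resolutionD F) (resolutionD_comp F)

lemma resolution_d (n : ℤ) : (resolution F).d n (n + 1) = resolutionD F n :=
  CochainComplex.of_d _ _ _

lemma resolution_isZero : ∀ n : ℤ, 0 < n → IsZero ((resolution F).X n)
  | .ofNat 0, h => absurd h (lt_irrefl _)
  | .ofNat (_ + 1), _ => isZero_zero _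
  | .negSucc n, h => absurd h (by simp)

lemma resolution_projective : ∀ n : ℤ, IsStrictlyProjective ((resolution F).X n)
  | .ofNat 0 => isStrictlyProjective_projCover _
  | .ofNat (_ + 1) => fun _ _ _ _ _ => ⟨0, (isZero_zero _).eq_of_src _ _⟩
  | .negSucc _ => isStrictlyProjective_projCover _

/-- The augmentation of the projective resolution of `F`. -/
def resolutionπ : (resolution F).X 0 ⟶ F := projCoverπ (syzygy F 0)

lemma liftsL1_resolutionπ : LiftsL1 (resolutionπ F) := liftsL1_projCoverπ F

lemma resolution_d_comp_π : (resolution F).d (-1) 0 ≫ resolutionπ F = 0 :=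
  (congrArg (· ≫ _) (resolution_d F (-1))).trans (syzygyD_comp_π F 0)

variable {F}

lemma exists_resolution_d_of_comp_π {S : Type u}
    (t : constInd.obj (l1 S) ⟶ (resolution F).X 0) (ht : t ≫ resolutionπ F = 0) :
    ∃ s, s ≫ (resolution F).d (-1) 0 = t := by
  obtain ⟨s, hs⟩ := exists_syzygyD_of_comp_π t ht
  exact ⟨s, (congrArg (s ≫ ·) (resolution_d F (-1))).trans hs⟩

lemma exists_resolution_d_of_comp {S : Type u} : ∀ (n : ℤ), n < 0 →
    ∀ (t : constInd.obj (l1 S) ⟶ (resolution F).X n), t ≫ (resolution F).d n (n + 1) = 0 →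
      ∃ s, s ≫ (resolution F).d (n - 1) n = t
  | .ofNat n, h, _, _ => absurd h (by simp)
  | .negSucc 0, _, t, ht => by
    obtain ⟨s, hs⟩ := exists_syzygyD_of_comp (F := F) t
      ((congrArg (t ≫ ·) (resolution_d F (-1))).symm.trans ht)
    exact ⟨s, (congrArg (s ≫ ·) (resolution_d F (-2))).trans hs⟩
  | .negSucc (n + 1), _, t, ht => by
    obtain ⟨s, hs⟩ := exists_syzygyD_of_comp (F := F) t
      ((congrArg (t ≫ ·) (resolution_d F (.negSucc (n + 1)))).symm.trans ht)
    exact ⟨s, (congrArg (s ≫ ·) (resolution_d F (.negSucc (n + 2)))).trans hs⟩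

end

/-! ### Acyclic cones and the augmentation -/

/-- Exactness of a mapping cone, in terms of generalized elements. -/
lemma exists_mappingCone_d {A : Type*} [Category* A] [Preadditive A] [HasZeroObject A]
    [HasBinaryBiproducts A] {K L : CochainComplex A ℤ} (φ : K ⟶ L) {T : A} (n : ℤ)
    (h : ∀ (a : T ⟶ K.X (n + 1)) (b : T ⟶ L.X n), a ≫ K.d (n + 1) (n + 1 + 1) = 0 →
      a ≫ φ.f (n + 1) + b ≫ L.d n (n + 1) = 0 →
        ∃ (a' : T ⟶ K.X n) (b' : T ⟶ L.X (n - 1)), a' ≫ K.d n (n + 1) = -a ∧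
          a' ≫ φ.f n + b' ≫ L.d (n - 1) n = b)
    (t : T ⟶ (CochainComplex.mappingCone φ).X n)
    (ht : t ≫ (CochainComplex.mappingCone φ).d n (n + 1) = 0) :
    ∃ s, s ≫ (CochainComplex.mappingCone φ).d (n - 1) n = t := by
  -- The components of `t` in `K.X (n + 1)` and `L.X n` are a cycle of the cone; its differential is
  -- `-d` on the `K` part, whence the sign of `a`.
  open CochainComplex.mappingCone in
  obtain ⟨a', b', ha, hb⟩ := h (t ≫ (fst φ).1.v n (n + 1) rfl) (t ≫ (snd φ).v n n (add_zero n)) (by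
      have := congrArg (· ≫ (fst φ).1.v (n + 1) (n + 1 + 1) rfl) ht
      simp only [Category.assoc, zero_comp] at this
      rw [d_fst_v φ n (n + 1) _ rfl rfl] at this
      simpa using this) (by
      have := congrArg (· ≫ (snd φ).v (n + 1) (n + 1) (add_zero _)) ht
      simp only [Category.assoc, zero_comp] at this
      rw [d_snd_v φ n (n + 1) rfl] at this
      simpa using this)
  refine ⟨a' ≫ (CochainComplex.mappingCone.inl φ).v n (n - 1) rfl +
    b' ≫ (CochainComplex.mappingCone.inr φ).f (n - 1), ?_⟩
  refine CochainComplex.mappingCone.ext_to φ n (n + 1) rfl ?_ ?_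
  · rw [Category.assoc, CochainComplex.mappingCone.d_fst_v φ (n - 1) n (n + 1) (by lia) rfl]
    simp [ha]
  · rw [Category.assoc, CochainComplex.mappingCone.d_snd_v φ (n - 1) n (by lia)]
    simp [hb]

lemma strictlyAcyclic_of_exists {K : CochainComplex IndBan.{w, u} ℤ}
    (h : ∀ (n : ℤ) (S : Type u) (t : constInd.obj (l1 S) ⟶ K.X n), t ≫ K.d n (n + 1) = 0 →
      ∃ s, s ≫ K.d (n - 1) n = t) :
    strictlyAcyclic IndBan.{w, u} ((HomotopyCategory.quotient _ _).obj K) := by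
  intro n
  rw [isStrictlyExact_iff]
  intro S t ht
  -- The neighbours of `n` in the complex shape equal `n - 1` and `n + 1` only propositionally, so
  -- they are first made variables.
  have key : ∀ i j : ℤ, i = n - 1 → j = n + 1 → ∀ (t : constInd.obj (l1 S) ⟶ K.X n),
      t ≫ K.d n j = 0 → ∃ s, s ≫ K.d i n = t := by
    rintro _ _ rfl rfl
    exact h n S
  exact key _ _ (CochainComplex.prev ℤ n) (CochainComplex.next ℤ n) t ht

open HomologicalComplex in
theorem nonempty_projRes (F : IndBan.{w, u}) : Nonempty (ProjRes F) := by
  let ε : resolution F ⟶ (single IndBan.{w, u} (ComplexShape.up ℤ) 0).obj F :=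
    mkHomToSingle (resolutionπ F) (by
      intro i hi
      obtain rfl : i = -1 := by simp at hi; lia
      exact resolution_d_comp_π F)
  have hε : ε.f 0 = resolutionπ F ≫ (singleObjXSelf _ _ _).inv := mkHomToSingle_f _ _
  refine ⟨⟨resolution F, resolution_isZero F, resolution_projective F, ε,
    ObjectProperty.trW.mk _ (HomotopyCategory.mappingCone_triangleh_distinguished ε)
      (strictlyAcyclic_of_exists fun n S => exists_mappingCone_d ε n fun a b ha hab => ?_)⟩⟩
  have hL (m : ℤ) (hm : m ≠ 0) : IsZero
      (((single IndBan.{w, u} (ComplexShape.up ℤ) 0).obj F).X m) :=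
    isZero_single_obj_X _ _ _ _ hm
  rcases lt_trichotomy n 0 with hn | rfl | hn
  -- In negative degree only the resolution in degree `n + 1` matters: `n = -1` uses exactness at
  -- the augmentation, lower `n` exactness inside the resolution.
  · have hb (b' : constInd.obj (l1 S) ⟶
        ((single IndBan.{w, u} (ComplexShape.up ℤ) 0).obj F).X n) : b' = b :=
      (hL n hn.ne).eq_of_tgt _ _
    have hab' : a ≫ ε.f (n + 1) = 0 := by
      rwa [(hL n hn.ne).eq_of_tgt b 0, zero_comp, add_zero] at hab
    obtain ⟨s, hs⟩ : ∃ s, s ≫ (resolution F).d n (n + 1) = -a := by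
      obtain rfl | ⟨m, rfl, hm⟩ : n = -1 ∨ ∃ m, n = m - 1 ∧ m < 0 := by
        by_cases h : n = -1
        · exact Or.inl h
        · exact Or.inr ⟨n + 1, by lia, by lia⟩
      · refine exists_resolution_d_of_comp_π (-a) ?_
        have : (a ≫ resolutionπ F) ≫ (singleObjXSelf (ComplexShape.up ℤ) 0 F).inv = 0 := by
          rw [Category.assoc, ← hε]
          exact hab'
        have := (cancel_mono _).1 (this.trans zero_comp.symm)
        exact (Preadditive.neg_comp _ _).trans (by rw [neg_eq_zero]; exact this)
      · have key : ∀ k : ℤ, k = m → ∀ a : constInd.obj (l1 S) ⟶ (resolution F).X k,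
            a ≫ (resolution F).d k (k + 1) = 0 →
              ∃ s, s ≫ (resolution F).d (m - 1) k = -a := by
          rintro _ rfl a ha
          exact exists_resolution_d_of_comp _ hm (-a) (by rw [Preadditive.neg_comp, ha, neg_zero])
        exact key _ (by lia) a ha
    exact ⟨s, 0, hs, hb _⟩
  -- In degree `0` exactness is the lifting of elements of `F` through the augmentation.
  · obtain ⟨s, hs⟩ := liftsL1_resolutionπ F S (b ≫ (singleObjXSelf _ _ _).hom)
    refine ⟨s, 0, (resolution_isZero F _ (by lia)).eq_of_tgt _ _, ?_⟩
    rw [zero_comp, add_zero, hε, ← Category.assoc, hs, Category.assoc, Iso.hom_inv_id,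
      Category.comp_id]
  · exact ⟨0, 0, (resolution_isZero F _ (by lia)).eq_of_tgt _ _, (hL n hn.ne').eq_of_tgt _ _⟩

/-! ### Strong duals of nuclear Fréchet spaces -/

section StrongDual

variable {X : Type u} [AddCommGroup X] [Module ℂ X]

section

variable [TopologicalSpace X] {D : Type u} [AddCommGroup D] [Module ℂ D] [TopologicalSpace D]
  (e : D ≃L[ℂ] (X →L[ℂ] ℂ)) {p : Seminorm ℂ X} {B : Disk D}

/-- For each `r` above the gauge, `d` is a multiple of an element of `B` by a scalar below `r`; then
`r` decreases to the gauge. -/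
lemma norm_apply_le_gauge_mul (hB : ∀ d ∈ B.carrier, ∀ x, ‖e d x‖ ≤ p x) (d : B.hull) (x : X) :
    ‖e d x‖ ≤ B.gauge d * p x := by
  have h : ∀ r, B.gauge d < r → ‖e d x‖ ≤ r * p x := by
    intro r hr
    obtain ⟨b, hb, hbr, d', hd', hd⟩ := exists_lt_of_gauge_lt B.absorbent hr
    have hd : (d : D) = (b : ℂ) • (d' : D) := by rw [← hd]; rfl
    rw [hd, map_smul, smul_apply, norm_smul, Complex.norm_real, Real.norm_of_nonneg hb.le]
    exact mul_le_mul hbr.le (hB _ hd' x) (norm_nonneg _) (hb.le.trans hbr.le)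
  refine ge_of_tendsto (f := fun r => r * p x) (x := nhdsWithin (B.gauge d) (Set.Ioi _)) ?_
    (Filter.eventually_of_mem self_mem_nhdsWithin h)
  exact ((continuous_id.mul continuous_const).tendsto _).mono_left nhdsWithin_le_nhds

/-- The extension of functionals bounded by `p` to the completion of `(X, p)`, on the linear hull
of a disk. -/
def hullToDual (hB : ∀ d ∈ B.carrier, ∀ x, ‖e d x‖ ≤ p x) : B.hull →ₗ[ℂ] completion p →L[ℂ] ℂ where
  toFun d := completionLift p (e d).toLinearMap
  -- Linearity in `d` is checked on the dense image of `X`, where the extension is the functional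
  -- itself.
  map_add' d d' := ContinuousLinearMap.coeFn_injective <|
    (denseRange_toCompletion p).equalizer (ContinuousLinearMap.continuous _)
      (ContinuousLinearMap.continuous _) (funext fun x => by
        have h (d : B.hull) := completionLift_coe p (e d).toLinearMap
          (norm_apply_le_gauge_mul e hB d) x
        refine (h (d + d')).trans (Eq.trans ?_ (congrArg₂ (· + ·) (h d) (h d')).symm)
        exact congrArg (fun ξ => ξ x) (map_add e (d : D) d'))
  map_smul' a d := ContinuousLinearMap.coeFn_injective <|
    (denseRange_toCompletion p).equalizer (ContinuousLinearMap.continuous _)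
      (ContinuousLinearMap.continuous _) (funext fun x => by
        have h (d : B.hull) := completionLift_coe p (e d).toLinearMap
          (norm_apply_le_gauge_mul e hB d) x
        refine (h (a • d)).trans (Eq.trans ?_ (congrArg (a • ·) (h d)).symm)
        exact congrArg (fun ξ => ξ x) (map_smul e a (d : D)))

/-- The operator from the completion of the linear hull of a disk of functionals bounded by `p` to
the dual of the completion of `(X, p)`. -/
def diskToDual (hB : ∀ d ∈ B.carrier, ∀ x, ‖e d x‖ ≤ p x) :
    completion B.gauge →L[ℂ] (completion p →L[ℂ] ℂ) :=
  completionLift B.gauge (hullToDual e hB)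

lemma diskToDual_apply (hB : ∀ d ∈ B.carrier, ∀ x, ‖e d x‖ ≤ p x) (d : B.hull) (x : X) :
    diskToDual e hB (toCompletion B.gauge d) (toCompletion p x) = e d x := by
  have h : diskToDual e hB (toCompletion B.gauge d) = hullToDual e hB d :=
    completionLift_coe (C := 1) B.gauge (hullToDual e hB) (fun d => by
      rw [one_mul]
      exact norm_completionLift_le p _ (apply_nonneg _ _) (norm_apply_le_gauge_mul e hB d)) d
  rw [h]
  exact completionLift_coe p (e d).toLinearMap (norm_apply_le_gauge_mul e hB d) x

end

section

variable [TopologicalSpace X] [IsTopologicalAddGroup X]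

/-- The canonical map from `X` to its completion for a continuous seminorm, as a continuous linear
map. -/
def toCompletionCLM (q : Seminorm ℂ X) (hq : Continuous q) : X →L[ℂ] completion q :=
  { toCompletion q with
    cont := continuous_of_continuousAt_zero (toCompletion q) (by
      rw [ContinuousAt, map_zero, tendsto_zero_iff_norm_tendsto_zero]
      simp only [norm_toCompletion]
      simpa using hq.tendsto 0) }

/-- A bounded set of `X` has bounded image in the completion for `q`, so `q` bounds all these
functionals uniformly on it. -/
lemma isVonNBounded_polar [ContinuousSMul ℂ X] (q : Seminorm ℂ X) (hq : Continuous q) :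
    Bornology.IsVonNBounded ℂ {ξ : X →L[ℂ] ℂ | ∀ x, ‖ξ x‖ ≤ q x} := by
  rw [ContinuousLinearMap.isVonNBounded_iff]
  intro s hs
  obtain ⟨C, hC⟩ := isBounded_iff_forall_norm_le.1
    ((NormedSpace.isVonNBounded_iff ℂ).1 (hs.image (toCompletionCLM q hq)))
  refine (NormedSpace.isVonNBounded_iff ℂ).2 (isBounded_iff_forall_norm_le.2 ⟨C, ?_⟩)
  rintro _ ⟨ξ, hξ, x, hx, rfl⟩
  refine (hξ x).trans ?_
  rw [← norm_toCompletion]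
  exact hC _ ⟨x, hx, rfl⟩

variable [ContinuousSMul ℂ X] {D : Type u} [AddCommGroup D] [Module ℂ D] [TopologicalSpace D]

/-- The disk of the functionals which are bounded by a continuous seminorm. -/
def polarDisk (e : D ≃L[ℂ] (X →L[ℂ] ℂ)) (q : Seminorm ℂ X) (hq : Continuous q) : Disk D where
  carrier := {d | ∀ x, ‖e d x‖ ≤ q x}
  nonempty := ⟨0, fun x => by simp⟩
  balanced := by
    rintro a ha _ ⟨d, hd, rfl⟩ x
    change ‖e (a • d) x‖ ≤ q x
    rw [map_smul, smul_apply, norm_smul]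
    exact (mul_le_of_le_one_left (norm_nonneg _) ha).trans (hd x)
  convex := by
    intro d hd d' hd' a b ha hb hab x
    rw [← Complex.coe_smul, ← Complex.coe_smul, map_add, map_smul, map_smul,
      add_apply, smul_apply, smul_apply]
    refine (norm_add_le _ _).trans ?_
    rw [norm_smul, norm_smul, Complex.norm_real, Complex.norm_real,
      Real.norm_of_nonneg ha, Real.norm_of_nonneg hb]
    calc a * ‖e d x‖ + b * ‖e d' x‖ ≤ a * q x + b * q x := by
          gcongr
          · exact hd x
          · exact hd' x
      _ = q x := by rw [← add_mul, hab, one_mul]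
  bounded := by
    refine ((isVonNBounded_polar q hq).image (e.symm : (X →L[ℂ] ℂ) →L[ℂ] D)).subset ?_
    exact fun d h => ⟨e d, h, e.symm_apply_apply d⟩

variable (e : D ≃L[ℂ] (X →L[ℂ] ℂ)) (q : Seminorm ℂ X) (hq : Continuous q)

lemma inv_smul_mem_polarDisk {d : D} {M : ℝ} (hM : 0 < M) (h : ∀ x, ‖e d x‖ ≤ M * q x) :
    M⁻¹ • d ∈ (polarDisk e q hq).carrier := by
  intro x
  rw [← Complex.coe_smul, map_smul, smul_apply, norm_smul, Complex.norm_real,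
    Real.norm_of_nonneg (by positivity), inv_mul_le_iff₀ hM]
  exact h x

lemma mem_hull_polarDisk {d : D} {M : ℝ} (h : ∀ x, ‖e d x‖ ≤ M * q x) :
    d ∈ (polarDisk e q hq).hull := by
  -- `M` may be zero or negative, while the rescaling needs a positive factor.
  have hM : 0 < max M 1 := lt_max_of_lt_right one_pos
  have := Submodule.smul_mem _ ((max M 1 : ℝ) : ℂ) (Submodule.subset_span (R := ℂ)
    (inv_smul_mem_polarDisk e q hq hM fun x => (h x).trans (by
      gcongr
      exact le_max_left _ _)))
  rwa [Complex.coe_smul, smul_inv_smul₀ hM.ne'] at this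

lemma gauge_polarDisk_le {d : (polarDisk e q hq).hull} {M : ℝ} (hM : 0 ≤ M)
    (h : ∀ x, ‖e d x‖ ≤ M * q x) : (polarDisk e q hq).gauge d ≤ M := by
  refine le_of_forall_gt_imp_ge_of_dense fun M' hM' => ?_
  have hM0 : 0 < M' := hM.trans_lt hM'
  refine gauge_le_of_mem hM0.le ((Set.mem_smul_set_iff_inv_smul_mem₀ hM0.ne' _ _).2 ?_)
  exact inv_smul_mem_polarDisk e q hq hM0 fun x => (h x).trans (by gcongr)

/-- The operator from the dual of the completion of `(X, q)` to the completion of the space of the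
functionals which are bounded by a multiple of `q`. -/
def dualToDisk : (completion q →L[ℂ] ℂ) →L[ℂ] completion (polarDisk e q hq).gauge :=
  have h (ξ : completion q →L[ℂ] ℂ) (x : X) :
      ‖e (e.symm (ξ.comp (toCompletionCLM q hq))) x‖ ≤ ‖ξ‖ * q x := by
    rw [e.apply_symm_apply, ← norm_toCompletion]
    exact ξ.le_opNorm _
  LinearMap.mkContinuous
    (toCompletion (polarDisk e q hq).gauge ∘ₗ LinearMap.codRestrict (polarDisk e q hq).hull
      { toFun ξ := e.symm (ξ.comp (toCompletionCLM q hq))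
        map_add' ξ ξ' := by rw [ContinuousLinearMap.add_comp, map_add]
        map_smul' a ξ := by rw [ContinuousLinearMap.smul_comp, map_smul]; rfl }
      fun ξ => mem_hull_polarDisk e q hq (h ξ)) 1
    fun ξ => by
      rw [one_mul]
      exact (norm_toCompletion _ _).trans_le (gauge_polarDisk_le e q hq (norm_nonneg _) (h ξ))

lemma dualToDisk_apply {ξ : completion q →L[ℂ] ℂ} {d : (polarDisk e q hq).hull}
    (h : ∀ x, ξ (toCompletion q x) = e d x) :
    dualToDisk e q hq ξ = toCompletion (polarDisk e q hq).gauge d := by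
  refine congrArg (toCompletion (polarDisk e q hq).gauge) (Subtype.ext ?_)
  exact (e.symm_apply_eq).2 (ContinuousLinearMap.ext h)

variable {p : Seminorm ℂ X} {B : Disk D}

/-- The transition operator factors as `D_B ⟶ (X_p)' ⟶ (X_q)' ⟶ D_polar`, with the transpose of `X_q
⟶ X_p` in the middle. Transposing `∑ cₙ ξₙ ⊗ yₙ` exchanges the roles of `ξₙ` and `yₙ`. -/
lemma isNuclearMap_diskSystem (hB : ∀ d ∈ B.carrier, ∀ x, ‖e d x‖ ≤ p x) {hf}
    (hN : IsNuclearMap (completionMap q p LinearMap.id hf)) (h : B ≤ polarDisk e q hq) :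
    IsNuclearMap ((diskSystem D).map (homOfLE h)) := by
  obtain ⟨c, ξ, y, hc, hξ, hy, hN⟩ := hN
  let N : completion q →L[ℂ] completion p := toCLM (completionMap q p LinearMap.id hf)
  obtain ⟨A, hA⟩ := isBounded_iff_forall_norm_le.1 hξ
  obtain ⟨A', hA'⟩ := isBounded_iff_forall_norm_le.1 hy
  have hA (n) : ‖ξ n‖ ≤ A := hA _ ⟨n, rfl⟩
  have hA' (n) : ‖y n‖ ≤ A' := hA' _ ⟨n, rfl⟩
  have hA0 : 0 ≤ A' := (norm_nonneg _).trans (hA' 0)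
  -- The transposed expansion converges in the norm of the dual; its sum is identified by evaluation
  -- at vectors.
  have hsum (η : completion p →L[ℂ] ℂ) : HasSum (fun n => (c n * η (y n)) • ξ n) (η.comp N) := by
    have hs : Summable fun n => (c n * η (y n)) • ξ n := by
      refine Summable.of_norm_bounded (g := fun n => ‖c n‖ * (‖η‖ * A' * A))
        (hc.norm.mul_right _) fun n => ?_
      rw [norm_smul, norm_mul, mul_assoc]
      gcongr
      · exact η.le_opNorm_of_le (hA' n)
      · exact hA n
    have : ∑' n, (c n * η (y n)) • ξ n = η.comp N := ContinuousLinearMap.ext fun v => by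
      refine (hs.hasSum.mapL (ContinuousLinearMap.apply ℂ ℂ v)).unique ?_
      have hn (n : ℕ) : η ((c n * ξ n v) • y n) = c n * η (y n) * ξ n v := by
        rw [map_smul, smul_eq_mul]
        ring
      have hv := (hN v).mapL η
      simp only [hn] at hv
      exact hv
    exact this ▸ hs.hasSum
  let R := diskToDual e hB
  let J := dualToDisk e q hq
  refine ⟨c, fun n => (ContinuousLinearMap.apply ℂ ℂ (y n)).comp R, fun n => J (ξ n), hc, ?_, ?_, ?_⟩
  · refine isBounded_iff_forall_norm_le.2 ⟨A' * ‖R‖, ?_⟩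
    rintro _ ⟨n, rfl⟩
    refine ContinuousLinearMap.opNorm_le_bound _ (by positivity) fun v => ?_
    calc ‖R v (y n)‖ ≤ ‖R v‖ * ‖y n‖ := (R v).le_opNorm _
      _ ≤ (‖R‖ * ‖v‖) * A' := by
        gcongr
        · exact R.le_opNorm v
        · exact hA' n
      _ = A' * ‖R‖ * ‖v‖ := by ring
  · refine isBounded_iff_forall_norm_le.2 ⟨‖J‖ * A, ?_⟩
    rintro _ ⟨n, rfl⟩
    exact J.le_opNorm_of_le (hA n)
  · intro v
    have hT : (diskSystem D).map (homOfLE h) =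
        J.comp (((ContinuousLinearMap.compL ℂ (completion q) (completion p) ℂ).flip N).comp R) :=
      completion_hom_ext fun d => by
        refine (completionMap_coe _ _ _ _ d).trans (dualToDisk_apply e q hq fun x => ?_).symm
        refine Eq.trans ?_ (diskToDual_apply e hB d x)
        exact congrArg (R (toCompletion B.gauge d)) (completionMap_coe q p LinearMap.id hf x)
    rw [hT]
    have hv := (hsum (R v)).mapL J
    simp only [map_smul] at hv
    exact hv

end

/-- A bounded set of functionals on a Fréchet space is bounded by a continuous seminorm. -/
lemma exists_seminorm_of_isVonNBounded [UniformSpace X] [IsUniformAddGroup X] [ContinuousSMul ℂ X]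
    [CompleteSpace X] [(uniformity X).IsCountablyGenerated] {S : Set (X →L[ℂ] ℂ)}
    (hS : Bornology.IsVonNBounded ℂ S) :
    ∃ p : Seminorm ℂ X, Continuous p ∧ ∀ ξ ∈ S, ∀ x, ‖ξ x‖ ≤ p x := by
  let p (ξ : S) : Seminorm ℂ X := (normSeminorm ℂ ℂ).comp (ξ : X →L[ℂ] ℂ).toLinearMap
  -- Boundedness of `S` on singletons gives pointwise boundedness.
  have hp : BddAbove (Set.range p) := by
    rw [Seminorm.bddAbove_range_iff]
    intro x
    obtain ⟨C, hC⟩ := isBounded_iff_forall_norm_le.1 ((NormedSpace.isVonNBounded_iff ℂ).1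
      (ContinuousLinearMap.isVonNBounded_iff.1 hS {x} (Bornology.isVonNBounded_singleton x)))
    refine ⟨C, ?_⟩
    rintro _ ⟨ξ, rfl⟩
    exact hC _ ⟨ξ, ξ.2, x, rfl, rfl⟩
  refine ⟨⨆ ξ, p ξ, ?_, fun ξ hξ x => ?_⟩
  · rw [Seminorm.coe_iSup_eq hp]
    -- A Fréchet space is barrelled by Baire's theorem, so a pointwise finite supremum of continuous
    -- seminorms is continuous.
    exact Seminorm.continuous_iSup p (fun ξ => (ξ : X →L[ℂ] ℂ).continuous.norm) hp
  · exact le_ciSup hp ⟨ξ, hξ⟩ x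

end StrongDual

/-- The ind-object `IB(D)` of a DFN space `D` is nuclear. -/
theorem isNuclear_IB (D : Type u) [AddCommGroup D] [Module ℂ D] [TopologicalSpace D]
    [IsTopologicalAddGroup D] [ContinuousSMul ℂ D] (hD : IsDFN D) : IsNuclear (IB.{w, u} D) := by
  obtain ⟨X, _, _, _, _, _, _, _, _, ⟨_, hX⟩, ⟨e⟩⟩ := hD
  refine ⟨ULift.{w} (Disk D), inferInstance, inferInstance, inferInstance, _, ?_, ⟨Iso.refl _⟩⟩
  rintro ⟨B⟩
  obtain ⟨p, hp, hBp⟩ := exists_seminorm_of_isVonNBounded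
    (B.bounded.image (e : D →L[ℂ] X →L[ℂ] ℂ))
  have hB : ∀ d ∈ B.carrier, ∀ x, ‖e d x‖ ≤ p x := fun d hd => hBp _ ⟨d, hd, rfl⟩
  obtain ⟨q, hq, hpq, hN⟩ := hX p hp
  -- Since `p ≤ q`, the polar of `q` is a later disk than `B`.
  have h : B ≤ polarDisk e q hq := fun d hd x => (hB d hd x).trans (hpq x)
  exact ⟨⟨polarDisk e q hq⟩, h, isNuclearMap_diskSystem e q hq hB hN h⟩

end

end BanInd

theorem mainTheorem9 :
    (∀ E F : IndBan.{w, u}, IsNuclear E →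
      Nonempty (ProjRes F) ∧ ∀ P : ProjRes F, IsIso (derivedTensorToTensor E P)) ∧
    (∀ (D : Type u) [AddCommGroup D] [Module ℂ D] [TopologicalSpace D] [IsTopologicalAddGroup D]
      [ContinuousSMul ℂ D], IsDFN D → IsNuclear (IB.{w, u} D)) :=
  ⟨fun _ F hE => ⟨nonempty_projRes F, fun P => isIso_derivedTensorToTensor hE P⟩,
    fun D _ _ _ _ _ hD => isNuclear_IB D hD⟩
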